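/- Let $(M,g)$ be a smooth Lorentzian 4-manifold (signature $(-,+,+,+)$), with Levi-Civita connection $\nabla$ and Ricci tensor $\mathrm{Ric}$. Let $K$ be a smooth complete vector field on $M$ that is null (nowhere zero and $g(K,K)=0$) and satisfies $\nabla_K K=0$ and $\mathrm{Ric}(K,K)>0$ everywhere on $M$. Let $f$ be a smooth function on $M$ whose derivative $K(f)$ along $K$ is nowhere zero. Then the exterior derivative $\omega = d\big(g(e^f K,\cdot)\big)$ of the 1-form $g(e^f K,\cdot)$ is a symplectic form on $M$, that is, a smooth closed nondegenerate 2-form, and the vector field $X = K/K(f)$ is a Liouville vector field for $\omega$, that is, $X$ is smooth and $\mathcal{L}_X\omega=\omega$. -/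

import Mathlib

open Set
open scoped Manifold ContDiff Topology

noncomputable section

/-- Coordinate space `ℝⁿ`. -/
abbrev RSpace (n : ℕ) : Type := EuclideanSpace ℝ (Fin n)

/-- A vector field (no smoothness assumed). -/
abbrev VField (n : ℕ) (M : Type*) [TopologicalSpace M] [ChartedSpace (RSpace n) M] :=
  (x : M) → TangentSpace (𝓡 n) x

/-- A differential form of degree `k` (no smoothness assumed). -/
abbrev DForm (n k : ℕ) (M : Type*) [TopologicalSpace M] [ChartedSpace (RSpace n) M] :=
  (x : M) → TangentSpace (𝓡 n) x [⋀^Fin k]→L[ℝ] ℝ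

section Smooth

variable {n k : ℕ} {M : Type*} [TopologicalSpace M] [ChartedSpace (RSpace n) M]
  [IsManifold (𝓡 n) ∞ M]

/-- Smooth vector fields. -/
def IsSmoothVField (X : VField n M) : Prop :=
  ContMDiff (𝓡 n) (𝓡 n).tangent ∞ (fun x => (⟨x, X x⟩ : TangentBundle (𝓡 n) M))

/-- The derivative `X(f)` of a function `f` along a vector field `X`. -/
def dirDeriv (X : VField n M) (f : M → ℝ) (x : M) : ℝ :=
  mvfderiv (𝓡 n) f x (X x)

/-- A vector field is complete if it has an integral curve defined on all of `ℝ` through each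
point. -/
def IsCompleteVField (X : VField n M) : Prop :=
  ∀ p : M, ∃ γ : ℝ → M, γ 0 = p ∧ IsMIntegralCurve γ X

/-! ### Differential forms -/

/-- The derivative at `y` of the inverse of the chart centred at `x₀`. -/
def chartInvDeriv (x₀ : M) (y : RSpace n) :
    RSpace n →L[ℝ] TangentSpace (𝓡 n) ((extChartAt (𝓡 n) x₀).symm y) :=
  mfderiv 𝓘(ℝ, RSpace n) (𝓡 n) (extChartAt (𝓡 n) x₀).symm y

/-- The derivative at `x` of the chart centred at `x₀`. -/
def chartDeriv (x₀ x : M) : TangentSpace (𝓡 n) x →L[ℝ] RSpace n :=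
  mfderiv (𝓡 n) 𝓘(ℝ, RSpace n) (extChartAt (𝓡 n) x₀) x

/-- The expression of a form in the chart centred at `x₀`: its pullback under the inverse chart. -/
def DForm.inChart (η : DForm n k M) (x₀ : M) (y : RSpace n) : RSpace n [⋀^Fin k]→L[ℝ] ℝ :=
  (η ((extChartAt (𝓡 n) x₀).symm y)).compContinuousLinearMap (chartInvDeriv x₀ y)

/-- Smooth differential forms. -/
def DForm.IsSmooth (η : DForm n k M) : Prop :=
  ∀ x₀ : M, ContDiffOn ℝ ∞ (DForm.inChart η x₀) (extChartAt (𝓡 n) x₀).target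

/-- The exterior derivative, computed at each point in the chart centred there. -/
def DForm.d (η : DForm n k M) : DForm n (k + 1) M := fun x =>
  (extDeriv (DForm.inChart η x) (extChartAt (𝓡 n) x x)).compContinuousLinearMap (chartDeriv x x)

/-- A symplectic form is a smooth, closed, nondegenerate 2-form. -/
structure DForm.IsSymplectic (η : DForm n 2 M) : Prop where
  smooth : DForm.IsSmooth η
  closed : ∀ x, DForm.d η x = 0
  nondegenerate : ∀ (x : M) (v : TangentSpace (𝓡 n) x), v ≠ 0 →
    ∃ w : TangentSpace (𝓡 n) x, η x ![v, w] ≠ 0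

/-- The Lie derivative of a form, evaluated on vector fields:
`(𝓛_X η)(Y₁, …, Yₖ) = X(η(Y₁, …, Yₖ)) - ∑ᵢ η(Y₁, …, [X, Yᵢ], …, Yₖ)`. -/
def DForm.lieDeriv (X : VField n M) (η : DForm n k M) (Y : Fin k → VField n M) (x : M) : ℝ :=
  dirDeriv X (fun y => η y (fun i => Y i y)) x -
    ∑ i, η x (Function.update (fun j => Y j x) i (VectorField.mlieBracket (𝓡 n) X (Y i) x))

/-- `X` is a Liouville vector field of `η`: it is smooth and `𝓛_X η = η`. -/
def DForm.IsLiouville (η : DForm n 2 M) (X : VField n M) : Prop :=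
  IsSmoothVField X ∧ ∀ Y : Fin 2 → VField n M, (∀ i, IsSmoothVField (Y i)) →
    ∀ x, DForm.lieDeriv X η Y x = η x (fun i => Y i x)

end Smooth

/-! ### Lorentzian geometry -/

/-- A (smooth) Lorentzian metric: a smooth symmetric bilinear form on the tangent bundle, of
signature `(-, +, …, +)` at every point (in particular nondegenerate). -/
structure LorentzMetric (n : ℕ) (M : Type*) [TopologicalSpace M] [ChartedSpace (RSpace n) M]
    [IsManifold (𝓡 n) ∞ M] where
  val : (x : M) → TangentSpace (𝓡 n) x →L[ℝ] TangentSpace (𝓡 n) x →L[ℝ] ℝ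
  symm : ∀ x v w, val x v w = val x w v
  signature : ∀ x, ∃ b : Module.Basis (Fin n) ℝ (TangentSpace (𝓡 n) x), ∀ i j,
    val x (b i) (b j) = if i = j then (if (i : ℕ) = 0 then -1 else 1) else 0
  contMDiff : ContMDiff (𝓡 n) ((𝓡 n).prod 𝓘(ℝ, RSpace n →L[ℝ] RSpace n →L[ℝ] ℝ)) ∞
    (fun x => Bundle.TotalSpace.mk' (RSpace n →L[ℝ] RSpace n →L[ℝ] ℝ)
      (E := fun x : M => TangentSpace (𝓡 n) x →L[ℝ] TangentSpace (𝓡 n) x →L[ℝ] ℝ) x (val x))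

namespace LorentzMetric

variable {n : ℕ} {M : Type*} [TopologicalSpace M] [ChartedSpace (RSpace n) M]
  [IsManifold (𝓡 n) ∞ M] (g : LorentzMetric n M)

/-- The metric in the chart centred at `x₀`. -/
def inChart (x₀ : M) (y : RSpace n) : RSpace n →L[ℝ] RSpace n →L[ℝ] ℝ :=
  (ContinuousLinearMap.precomp ℝ (chartInvDeriv x₀ y)).comp
    ((g.val ((extChartAt (𝓡 n) x₀).symm y)).comp (chartInvDeriv x₀ y))

/-- The Christoffel symbols in the chart centred at `x₀`, as the bilinear map `Γ w u = Γ(u, w)`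
determined by `g(Γ(u, w), z) = ½ (∂_u g(w, z) + ∂_w g(u, z) - ∂_z g(w, u))`. -/
def christoffel (x₀ : M) (y w : RSpace n) : RSpace n →L[ℝ] RSpace n :=
  (1 / 2 : ℝ) • (g.inChart x₀ y).inverse.comp
    ((fderiv ℝ (g.inChart x₀) y).flip w + fderiv ℝ (g.inChart x₀) y w -
      ((fderiv ℝ (g.inChart x₀) y).flip w).flip)

/-- The Levi-Civita connection: `g.covDeriv Y x v` is `∇_v Y` at `x`, given in the chart centred
at `x` by `DY(v) + Γ(v, Y)`. -/
def covDeriv (Y : VField n M) (x : M) : TangentSpace (𝓡 n) x →L[ℝ] TangentSpace (𝓡 n) x :=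
  let y₀ : RSpace n := extChartAt (𝓡 n) x x
  let Y' : RSpace n → RSpace n := fun y =>
    chartDeriv x ((extChartAt (𝓡 n) x).symm y) (Y ((extChartAt (𝓡 n) x).symm y))
  (chartDeriv x x).inverse.comp ((fderiv ℝ Y' y₀ + g.christoffel x y₀ (Y' y₀)).comp
    (chartDeriv x x))

/-- The curvature `R(X, Y)Z = ∇_X ∇_Y Z - ∇_Y ∇_X Z - ∇_{[X, Y]} Z`. -/
def curvature (X Y Z : VField n M) (x : M) : TangentSpace (𝓡 n) x :=
  g.covDeriv (fun y => g.covDeriv Z y (Y y)) x (X x) -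
    g.covDeriv (fun y => g.covDeriv Z y (X y)) x (Y x) -
    g.covDeriv Z x (VectorField.mlieBracket (𝓡 n) X Y x)

/-- The `i`-th coordinate vector field `∂ᵢ` of the chart centred at `x₀` (only meaningful on the
domain of this chart). -/
def coordField (x₀ : M) (i : Fin n) : VField n M := fun x =>
  (chartDeriv x₀ x).inverse (EuclideanSpace.single i (1 : ℝ))

/-- The Ricci curvature `Ric(Y, Z)`, the trace of `v ↦ R(v, Y)Z`: at `x` it is
`∑ᵢ dxⁱ(R(∂ᵢ, Y)Z)` in the chart centred at `x`. -/
def ricci (Y Z : VField n M) (x : M) : ℝ :=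
  ∑ i, (chartDeriv x x (g.curvature (coordField x i) Y Z x)) i

/-- The 1-form `g(X, ·)` metrically equivalent to the vector field `X`. -/
def flat (X : VField n M) : DForm n 1 M := fun x =>
  ContinuousAlternatingMap.ofSubsingleton ℝ (TangentSpace (𝓡 n) x) ℝ (0 : Fin 1) (g.val x (X x))

/-- A null vector field: nowhere zero and orthogonal to itself. -/
def IsNull (X : VField n M) : Prop := ∀ x, X x ≠ 0 ∧ g.val x (X x) (X x) = 0

end LorentzMetric

end

/-!
Write `a = g(K, ·)` and `ω = d(e^f a)`. Since `K` is geodesic and null, `∇K` kills `K` and takes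
values in `K^⊥`; as `da(u, v) = g(∇_u K, v) - g(∇_v K, u)` (`curl_lower`), this gives `i_K da = 0`,
and together with `a(K) = 0` also `i_K ω = e^f K(f) a`. For `X = K/K(f)` this reads `i_X ω = e^f a`,
so `𝓛_X ω = d(i_X ω) = ω` by Cartan's formula (`isLiouville_d_flat`).

If `ω(v, ·) = 0`, then pairing with `K` gives `v ∈ K^⊥`, and pairing with `K^⊥` gives
`da(v, ·) = 0` on `K^⊥`. Now `da` descends to a 2-form on the plane `K^⊥/K`. If it is nonzero there,
then it is nondegenerate there, so `v` is a multiple of `K`, and then `v = 0` because `i_K ω` is a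
nonzero multiple of `a` (`nondegenerate_d_flat_exp_smul`).

So the point is that `da` vanishes on `K^⊥` nowhere (`not_isTwistFreeAt`), and this is where
completeness and `Ric(K, K) > 0` enter. The 3-form `a ∧ da` is invariant under the flow of `K`
(`wedge_curl_propagates`), so if `da` vanishes on `K^⊥` at one point, then it does so along the
integral curve through this point (`IsTwistFreeAt.of_integralCurve`), which is defined on all of
`ℝ`.
On this curve `∇K` induces a symmetric endomorphism of the Euclidean plane `K^⊥/K`, so that
`tr (∇K)² ≥ θ²/2` for `θ = tr ∇K` (`sq_trace_le_of_symm`). Raychaudhuri's equation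
`θ' = -Ric(K, K) - tr (∇K)²` (`hasDerivAt_divergence`) then yields `θ' < -θ²/2` on the whole line,
which is impossible (`not_forall_riccati_lt`).

Forms, the connection and the Ricci curvature are defined through the chart centred at each point.
The geometric identities are proved for metrics on open subsets of a vector space, and transferred
by the fact that the exterior derivative and the covariant derivative may be computed in any chart
(`inChart_d`, `chartDeriv_covDeriv`).
-/

noncomputable section

/-! ### Christoffel symbols of a metric on a vector space -/

section Christoffel

variable {E : Type*} [NormedAddCommGroup E] [NormedSpace ℝ E]

/-- The Christoffel symbols of a metric `G` on (an open subset of) a vector space, as the bilinear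
map `Γ w u = Γ(u, w)`. -/
def coordChristoffel (G : E → E →L[ℝ] E →L[ℝ] ℝ) (y w : E) : E →L[ℝ] E :=
  (1 / 2 : ℝ) • (G y).inverse.comp
    ((fderiv ℝ G y).flip w + fderiv ℝ G y w - ((fderiv ℝ G y).flip w).flip)

variable {G : E → E →L[ℝ] E →L[ℝ] ℝ} {y : E}

lemma metric_coordChristoffel (hG : (G y).IsInvertible) (w u z : E) :
    G y (coordChristoffel G y w u) z =
      (1 / 2) * (fderiv ℝ G y u w z + fderiv ℝ G y w u z - fderiv ℝ G y z w u) := by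
  simp [coordChristoffel, hG.self_apply_inverse]

lemma fderiv_apply_apply (hd : DifferentiableAt ℝ G y) (u v w : E) :
    fderiv ℝ (fun y' => G y' v w) y u = fderiv ℝ G y u v w := by
  have h1 : HasFDerivAt (fun y' => G y' v) ((fderiv ℝ G y).flip v) y := by
    simpa using hd.hasFDerivAt.clm_apply (hasFDerivAt_const v y)
  have h2 : HasFDerivAt (fun y' => G y' v w) (((fderiv ℝ G y).flip v).flip w) y := by
    simpa using h1.clm_apply (hasFDerivAt_const w y)
  rw [h2.fderiv]; rfl

lemma fderiv_metric_symm (hd : DifferentiableAt ℝ G y)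
    (hs : ∀ᶠ y' in 𝓝 y, ∀ u v, G y' u v = G y' v u) (u v w : E) :
    fderiv ℝ G y u v w = fderiv ℝ G y u w v := by
  rw [← fderiv_apply_apply hd, ← fderiv_apply_apply hd]
  have : (fun y' => G y' v w) =ᶠ[𝓝 y] fun y' => G y' w v := by
    filter_upwards [hs] with y' h using h v w
  rw [this.fderiv_eq]

/-- A nondegenerate form separates vectors. -/
lemma eq_of_metric_eq {A : E →L[ℝ] E →L[ℝ] ℝ} (hA : A.IsInvertible) {u v : E}
    (h : ∀ z, A u z = A v z) : u = v := by
  have : A u = A v := by ext z; exact h z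
  rw [← hA.inverse_apply_self u, this, hA.inverse_apply_self]

/-- The connection is torsion-free. -/
lemma coordChristoffel_symm (hd : DifferentiableAt ℝ G y)
    (hs : ∀ᶠ y' in 𝓝 y, ∀ u v, G y' u v = G y' v u) (hG : (G y).IsInvertible) (u w : E) :
    coordChristoffel G y w u = coordChristoffel G y u w := by
  refine eq_of_metric_eq hG fun z => ?_
  rw [metric_coordChristoffel hG, metric_coordChristoffel hG, fderiv_metric_symm hd hs z w u]
  ring

/-- The first derivatives of the pullback `G = ψ^* G'` of a metric. -/
lemma fderiv_pullback_metric {G' : E → E →L[ℝ] E →L[ℝ] ℝ} {ψ : E → E}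
    (hψ : ContDiffAt ℝ 2 ψ y) (hG' : DifferentiableAt ℝ G' (ψ y)) (hGd : DifferentiableAt ℝ G y)
    (hpull : ∀ᶠ y' in 𝓝 y, ∀ u v, G y' u v = G' (ψ y') (fderiv ℝ ψ y' u) (fderiv ℝ ψ y' v))
    (u w z : E) :
    fderiv ℝ G y u w z =
      fderiv ℝ G' (ψ y) (fderiv ℝ ψ y u) (fderiv ℝ ψ y w) (fderiv ℝ ψ y z)
        + G' (ψ y) (fderiv ℝ (fderiv ℝ ψ) y u w) (fderiv ℝ ψ y z)
        + G' (ψ y) (fderiv ℝ ψ y w) (fderiv ℝ (fderiv ℝ ψ) y u z) := by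
  have hD : HasFDerivAt (fderiv ℝ ψ) (fderiv ℝ (fderiv ℝ ψ) y) y :=
    ((hψ.fderiv_right (m := 1) (by norm_num)).differentiableAt one_ne_zero).hasFDerivAt
  have hψ1 : HasFDerivAt ψ (fderiv ℝ ψ y) y := (hψ.differentiableAt two_ne_zero).hasFDerivAt
  have h1 : HasFDerivAt (fun y' => G' (ψ y')) ((fderiv ℝ G' (ψ y)).comp (fderiv ℝ ψ y)) y :=
    HasFDerivAt.comp (g := G') y hG'.hasFDerivAt hψ1
  have h2 := (h1.clm_apply (hD.clm_apply (hasFDerivAt_const w y))).clm_apply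
    (hD.clm_apply (hasFDerivAt_const z y))
  have h3 : (fun y' => G y' w z) =ᶠ[𝓝 y]
      fun y' => G' (ψ y') (fderiv ℝ ψ y' w) (fderiv ℝ ψ y' z) := by
    filter_upwards [hpull] with y' h using h w z
  rw [← fderiv_apply_apply hGd, h3.fderiv_eq]
  have h4 := h2.fderiv
  rw [h4]
  simp
  ring

/-- The transformation law of the Christoffel symbols under a local diffeomorphism `ψ`. -/
lemma fderiv_coordChristoffel {G' : E → E →L[ℝ] E →L[ℝ] ℝ} {ψ : E → E}
    (hψ : ContDiffAt ℝ 2 ψ y) (hinv : (fderiv ℝ ψ y).IsInvertible)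
    (hG' : DifferentiableAt ℝ G' (ψ y)) (hGd : DifferentiableAt ℝ G y)
    (hpull : ∀ᶠ y' in 𝓝 y, ∀ u v, G y' u v = G' (ψ y') (fderiv ℝ ψ y' u) (fderiv ℝ ψ y' v))
    (hs : ∀ u v, G' (ψ y) u v = G' (ψ y) v u)
    (hG : (G y).IsInvertible) (hGi' : (G' (ψ y)).IsInvertible) (w u : E) :
    fderiv ℝ ψ y (coordChristoffel G y w u) =
      fderiv ℝ (fderiv ℝ ψ) y u w +
        coordChristoffel G' (ψ y) (fderiv ℝ ψ y w) (fderiv ℝ ψ y u) := by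
  have hsymm : ∀ a b, fderiv ℝ (fderiv ℝ ψ) y a b = fderiv ℝ (fderiv ℝ ψ) y b a :=
    fun a b => (hψ.isSymmSndFDerivAt (by simp)).eq a b
  refine eq_of_metric_eq hGi' fun z' => ?_
  obtain ⟨z, rfl⟩ : ∃ z, fderiv ℝ ψ y z = z' :=
    ⟨(fderiv ℝ ψ y).inverse z', hinv.self_apply_inverse z'⟩
  rw [← hpull.self_of_nhds, metric_coordChristoffel hG, map_add, add_apply,
    metric_coordChristoffel hGi']
  simp only [fderiv_pullback_metric hψ hG' hGd hpull]
  rw [hsymm w u, hsymm z u, hsymm z w, hs _ (fderiv ℝ (fderiv ℝ ψ) y w z),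
    hs _ (fderiv ℝ (fderiv ℝ ψ) y u z)]
  ring

/-- The covariant derivative `v ↦ ∇_v Y = DY(v) + Γ(v, Y)` of a vector field for the Levi-Civita
connection of a metric `G` on (an open subset of) a vector space. -/
def coordCovDeriv (G : E → E →L[ℝ] E →L[ℝ] ℝ) (Y : E → E) (y : E) : E →L[ℝ] E :=
  fderiv ℝ Y y + coordChristoffel G y (Y y)

/-- Covariant derivatives are natural under local diffeomorphisms. -/
lemma fderiv_coordCovDeriv {G' : E → E →L[ℝ] E →L[ℝ] ℝ} {ψ : E → E}
    (hψ : ContDiffAt ℝ 2 ψ y) (hinv : (fderiv ℝ ψ y).IsInvertible)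
    (hG' : DifferentiableAt ℝ G' (ψ y)) (hGd : DifferentiableAt ℝ G y)
    (hpull : ∀ᶠ y' in 𝓝 y, ∀ u v, G y' u v = G' (ψ y') (fderiv ℝ ψ y' u) (fderiv ℝ ψ y' v))
    (hs : ∀ u v, G' (ψ y) u v = G' (ψ y) v u)
    (hG : (G y).IsInvertible) (hGi' : (G' (ψ y)).IsInvertible)
    {Y Y' : E → E} (hY : DifferentiableAt ℝ Y y) (hY' : DifferentiableAt ℝ Y' (ψ y))
    (hYY' : ∀ᶠ y' in 𝓝 y, Y' (ψ y') = fderiv ℝ ψ y' (Y y')) (v : E) :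
    coordCovDeriv G' Y' (ψ y) (fderiv ℝ ψ y v) = fderiv ℝ ψ y (coordCovDeriv G Y y v) := by
  change fderiv ℝ Y' (ψ y) (fderiv ℝ ψ y v) +
      coordChristoffel G' (ψ y) (Y' (ψ y)) (fderiv ℝ ψ y v) =
    fderiv ℝ ψ y (fderiv ℝ Y y v + coordChristoffel G y (Y y) v)
  have hD : HasFDerivAt (fderiv ℝ ψ) (fderiv ℝ (fderiv ℝ ψ) y) y :=
    ((hψ.fderiv_right (m := 1) (by norm_num)).differentiableAt one_ne_zero).hasFDerivAt
  have hψ1 : HasFDerivAt ψ (fderiv ℝ ψ y) y := (hψ.differentiableAt two_ne_zero).hasFDerivAt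
  have h1 := (hY'.hasFDerivAt.comp y hψ1).fderiv
  have h2 := (hD.clm_apply hY.hasFDerivAt).fderiv
  have h3 : fderiv ℝ (Y' ∘ ψ) y = fderiv ℝ (fun y' => fderiv ℝ ψ y' (Y y')) y :=
    Filter.EventuallyEq.fderiv_eq hYY'
  rw [h1, h2] at h3
  have h4 := DFunLike.congr_fun h3 v
  simp at h4
  rw [map_add, fderiv_coordChristoffel hψ hinv hG' hGd hpull hs hG hGi', h4,
    hYY'.self_of_nhds]
  abel

/-- The exterior derivative `da(u, v) = (D_u a) v - (D_v a) u` of a 1-form `a` on (an open subset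
of) a vector space, as a bilinear map. -/
def curl (a : E → E →L[ℝ] ℝ) (y : E) : E →L[ℝ] E →L[ℝ] ℝ :=
  fderiv ℝ a y - (fderiv ℝ a y).flip

lemma curl_apply (a : E → E →L[ℝ] ℝ) (y u v : E) :
    curl a y u v = fderiv ℝ a y u v - fderiv ℝ a y v u := rfl

lemma LinearIsometryEquiv.comp_differentiableAt {F G : Type*} [NormedAddCommGroup F]
    [NormedSpace ℝ F] [NormedAddCommGroup G] [NormedSpace ℝ G] (L : F ≃ₗᵢ[ℝ] G) {f : E → F}
    (hf : DifferentiableAt ℝ f y) : DifferentiableAt ℝ (fun y' => L (f y')) y := by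
  fun_prop

lemma DifferentiableAt.clm_flip {F H W : Type*} [NormedAddCommGroup F] [NormedSpace ℝ F]
    [NormedAddCommGroup H] [NormedSpace ℝ H] [NormedAddCommGroup W] [NormedSpace ℝ W]
    {f : E → F →L[ℝ] H →L[ℝ] W} (hf : DifferentiableAt ℝ f y) :
    DifferentiableAt ℝ (fun y' => (f y').flip) y :=
  LinearIsometryEquiv.comp_differentiableAt (F := F →L[ℝ] H →L[ℝ] W)
    (G := H →L[ℝ] F →L[ℝ] W) (ContinuousLinearMap.flipₗᵢ ℝ F H W) hf

lemma differentiableAt_curl {a : E → E →L[ℝ] ℝ} (ha : ContDiffAt ℝ 2 a y) :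
    DifferentiableAt ℝ (curl a) y := by
  have hD : DifferentiableAt ℝ (fderiv ℝ a) y :=
    ((ha.fderiv_right (m := 1) (by norm_num)).differentiableAt one_ne_zero)
  have h : DifferentiableAt ℝ (fun y' => (fderiv ℝ a y').flip) y := hD.clm_flip
  exact DifferentiableAt.fun_sub (𝕜 := ℝ) (F := E →L[ℝ] E →L[ℝ] ℝ) hD h

/-- Closedness of `da`. -/
lemma fderiv_curl_cyclic {a : E → E →L[ℝ] ℝ} (ha : ContDiffAt ℝ 2 a y) (u v w : E) :
    fderiv ℝ (curl a) y u v w + fderiv ℝ (curl a) y v w u + fderiv ℝ (curl a) y w u v = 0 := by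
  have hsymm : ∀ b c, fderiv ℝ (fderiv ℝ a) y b c = fderiv ℝ (fderiv ℝ a) y c b :=
    fun b c => (ha.isSymmSndFDerivAt (by simp)).eq b c
  have hD : HasFDerivAt (fderiv ℝ a) (fderiv ℝ (fderiv ℝ a) y) y :=
    ((ha.fderiv_right (m := 1) (by norm_num)).differentiableAt one_ne_zero).hasFDerivAt
  have hc := differentiableAt_curl ha
  have key : ∀ u v w, fderiv ℝ (curl a) y u v w =
      fderiv ℝ (fderiv ℝ a) y u v w - fderiv ℝ (fderiv ℝ a) y u w v := by
    intro u v w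
    rw [← fderiv_apply_apply hc, ← fderiv_apply_apply hD.differentiableAt,
      ← fderiv_apply_apply hD.differentiableAt]
    have e : ∀ p q, DifferentiableAt ℝ (fun y' => fderiv ℝ a y' p q) y := fun p q =>
      (hD.differentiableAt.clm_apply (differentiableAt_const p)).clm_apply
        (differentiableAt_const q)
    simp only [curl_apply]
    rw [fderiv_fun_sub (e _ _) (e _ _)]; rfl
  rw [key, key, key, hsymm v u, hsymm v w, hsymm w u]
  ring

/-- Cartan's formula for the 2-form `da`: if `i_X da = t`, then `𝓛_X da = dt`. -/
lemma lieDeriv_curl {a t : E → E →L[ℝ] ℝ} {X : E → E} (ha : ContDiffAt ℝ 2 a y)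
    (hX : DifferentiableAt ℝ X y) (ht : ∀ᶠ y' in 𝓝 y, curl a y' (X y') = t y') (u v : E) :
    fderiv ℝ (curl a) y (X y) u v + curl a y (fderiv ℝ X y u) v + curl a y u (fderiv ℝ X y v) =
      curl t y u v := by
  have hc := differentiableAt_curl ha
  have h1 := Filter.EventuallyEq.fderiv_eq (𝕜 := ℝ) ht
  have h0 : HasFDerivAt (fun y' => curl a y' (X y')) ((curl a y).comp (fderiv ℝ X y) +
      (fderiv ℝ (curl a) y).flip (X y)) y := hc.hasFDerivAt.clm_apply hX.hasFDerivAt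
  rw [h0.fderiv] at h1
  have h2 : ∀ y' p q, curl a y' p q = - curl a y' q p := by
    intro y' p q; simp [curl_apply]
  have h3 : ∀ p q r, fderiv ℝ (curl a) y p q r = - fderiv ℝ (curl a) y p r q := by
    intro p q r
    rw [← fderiv_apply_apply hc, ← fderiv_apply_apply hc]
    simp only [h2 _ q r]
    simp [fderiv_fun_neg]
  rw [curl_apply t, ← h1]
  simp
  have h4 := fderiv_curl_cyclic ha (X y) u v
  rw [h2 _ u (fderiv ℝ X y v), h3 u (X y) v]
  linarith

end Christoffel

/-! ### Linear algebra of a null vector in Lorentzian 4-space -/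

section NullVector

variable {E : Type*} [NormedAddCommGroup E] [NormedSpace ℝ E]

/-- The basis `b` is Lorentz-orthonormal: its Gram matrix is `diag(-1, 1, 1, 1)`. -/
def IsLorentzBasis (q : E →L[ℝ] E →L[ℝ] ℝ) (b : Module.Basis (Fin 4) ℝ E) : Prop :=
  ∀ i j, q (b i) (b j) = if i = j then (if (i : ℕ) = 0 then -1 else 1) else 0

lemma linearIndependent_of_gram {q : E →L[ℝ] E →L[ℝ] ℝ} {w : Fin 4 → E}
    (hw : ∀ i j, q (w i) (w j) = if i = j then (if (i : ℕ) = 0 then -1 else 1) else 0) :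
    LinearIndependent ℝ w := by
  rw [Fintype.linearIndependent_iff]
  intro c hc j
  have h : q (∑ i, c i • w i) (w j) = 0 := by rw [hc]; simp
  simp only [map_sum, map_smul, sum_apply, smul_apply,
    hw, smul_eq_mul, mul_ite, mul_zero, Finset.sum_ite_eq', Finset.mem_univ, if_true] at h
  split_ifs at h <;> linarith

/-- A nonzero null vector is a multiple of `b₀ + b₁` for some Lorentz-orthonormal basis `b`. -/
lemma exists_adapted_basis {q : E →L[ℝ] E →L[ℝ] ℝ} {b : Module.Basis (Fin 4) ℝ E}
    (hb : IsLorentzBasis q b) {k : E} (hk : k ≠ 0) (hq : q k k = 0) :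
    ∃ (b' : Module.Basis (Fin 4) ℝ E) (c : ℝ),
      IsLorentzBasis q b' ∧ c ≠ 0 ∧ k = c • (b' 0 + b' 1) := by
  have hg : ∀ i j : Fin 4, q (b i) (b j) = if i = j then (if (i : ℕ) = 0 then -1 else 1) else 0 :=
    hb
  obtain ⟨κ, hκ⟩ : ∃ κ : Fin 4 → ℝ, κ = b.repr k := ⟨_, rfl⟩
  have hk' : k = κ 0 • b 0 + κ 1 • b 1 + κ 2 • b 2 + κ 3 • b 3 := by
    rw [hκ, ← Fin.sum_univ_four (f := fun i => b.repr k i • b i), b.sum_repr]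
  have hnorm : κ 0 ^ 2 = κ 1 ^ 2 + κ 2 ^ 2 + κ 3 ^ 2 := by
    rw [hk'] at hq
    simp [hg] at hq
    linarith
  have hκ0 : κ 0 ≠ 0 := by
    intro h0
    rw [h0] at hnorm
    have h1 : κ 1 = 0 := by nlinarith [sq_nonneg (κ 1), sq_nonneg (κ 2), sq_nonneg (κ 3)]
    have h2 : κ 2 = 0 := by nlinarith [sq_nonneg (κ 1), sq_nonneg (κ 2), sq_nonneg (κ 3)]
    have h3 : κ 3 = 0 := by nlinarith [sq_nonneg (κ 1), sq_nonneg (κ 2), sq_nonneg (κ 3)]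
    exact hk (by rw [hk', h0, h1, h2, h3]; simp)
  -- The spatial part of `k` divided by `κ₀` is a unit vector because `k` is null. Extend it to an
  -- orthonormal basis of 3-space.
  let ν : EuclideanSpace ℝ (Fin 3) := !₂[κ 1 / κ 0, κ 2 / κ 0, κ 3 / κ 0]
  have hν : ‖ν‖ = 1 := by
    rw [EuclideanSpace.norm_eq, Real.sqrt_eq_one, Fin.sum_univ_three]
    simp [ν, div_pow]
    field_simp
    linarith
  obtain ⟨o, ho⟩ := Orthonormal.exists_orthonormalBasis_extension_of_card_eq
    (𝕜 := ℝ) (E := EuclideanSpace ℝ (Fin 3)) (ι := Fin 3) (by simp) (v := fun _ => ν) (s := {0})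
    (by
      constructor
      · intro i; simpa using hν
      · intro i j hij; exact absurd (Subsingleton.elim i j) hij)
  have ho0 : o 0 = ν := ho 0 rfl
  have hoo : ∀ i j, o i 0 * o j 0 + o i 1 * o j 1 + o i 2 * o j 2 = if i = j then 1 else 0 := by
    intro i j
    have := orthonormal_iff_ite.1 o.orthonormal i j
    rw [← this, PiLp.inner_apply, Fin.sum_univ_three]
    simp; ring
  -- The spatial part of `k` is `κ₀ ν` with `ν = o 0`, hence `k = κ₀ (w₀ + w₁)`.
  let w : Fin 4 → E := Fin.cons (b 0) fun j => o j 0 • b 1 + o j 1 • b 2 + o j 2 • b 3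
  have hw : ∀ i j, q (w i) (w j) = if i = j then (if (i : ℕ) = 0 then -1 else 1) else 0 := by
    intro i j
    refine Fin.cases ?_ (fun i => ?_) i <;> refine Fin.cases ?_ (fun j => ?_) j
    · simp [w, hg]
    · simp [w, hg]
      exact fun h => absurd h.symm (Fin.succ_ne_zero j)
    · simp [w, hg]
    · simp [w, hg]
      rw [← hoo i j]
  have : FiniteDimensional ℝ E := b.finiteDimensional_of_finite
  have hcard : Fintype.card (Fin 4) = Module.finrank ℝ E := (Module.finrank_eq_card_basis b).symm
  refine ⟨basisOfLinearIndependentOfCardEqFinrank (linearIndependent_of_gram hw) hcard, κ 0,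
    fun i j => by simpa using hw i j, hκ0, ?_⟩
  have h1 : w 1 = o 0 0 • b 1 + o 0 1 • b 2 + o 0 2 • b 3 := rfl
  have h0 : w 0 = b 0 := rfl
  rw [coe_basisOfLinearIndependentOfCardEqFinrank, h0, h1, ho0]
  simp only [ν, smul_add, smul_smul]
  simp [mul_div_cancel₀, hκ0]
  rw [hk']
  abel

lemma IsLorentzBasis.repr_eq {q : E →L[ℝ] E →L[ℝ] ℝ} {b : Module.Basis (Fin 4) ℝ E}
    (hb : IsLorentzBasis q b) (v : E) (i : Fin 4) :
    b.repr v i = (if (i : ℕ) = 0 then -1 else 1) * q v (b i) := by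
  have h : q (∑ j, b.repr v j • b j) (b i) = q v (b i) := by rw [b.sum_repr]
  have hg : ∀ i j : Fin 4, q (b i) (b j) = if i = j then (if (i : ℕ) = 0 then -1 else 1) else 0 :=
    hb
  simp only [map_sum, map_smul, sum_apply, smul_apply,
    hg, smul_eq_mul, mul_ite, mul_zero, Finset.sum_ite_eq', Finset.mem_univ, if_true] at h
  rw [← h]
  split_ifs <;> ring

/-- Let `A` annihilate a null vector `k`, take values in `k^⊥`, and be symmetric on `k^⊥`. Then `A`
induces a symmetric endomorphism of the Euclidean plane `k^⊥/k`, with the same traces. -/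
lemma sq_trace_le_of_symm {q : E →L[ℝ] E →L[ℝ] ℝ} {b : Module.Basis (Fin 4) ℝ E}
    (hb : IsLorentzBasis q b) {k : E} (hk : k ≠ 0) (hq : q k k = 0) {A : E →ₗ[ℝ] E}
    (hAk : A k = 0) (hA : ∀ v, q (A v) k = 0)
    (hsymm : ∀ u v, q k u = 0 → q k v = 0 → q (A u) v = q (A v) u) :
    LinearMap.trace ℝ E A ^ 2 ≤ 2 * LinearMap.trace ℝ E (A ∘ₗ A) := by
  obtain ⟨e, c, he, hc, rfl⟩ := exists_adapted_basis hb hk hq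
  have hg : ∀ i j : Fin 4, q (e i) (e j) = if i = j then (if (i : ℕ) = 0 then -1 else 1) else 0 :=
    he
  have h1 : A (e 1) = - A (e 0) := by
    rw [map_smul, smul_eq_zero, map_add] at hAk
    exact (neg_eq_of_add_eq_zero_right (hAk.resolve_left hc)).symm
  have h2 : ∀ v, q (A v) (e 1) = - q (A v) (e 0) := by
    intro v
    have := hA v
    rw [map_smul, smul_eq_zero, map_add] at this
    linarith [this.resolve_left hc]
  have h3 : q (A (e 2)) (e 3) = q (A (e 3)) (e 2) := by
    apply hsymm <;> simp [hg]
  -- In the basis `e` the contributions of `e₀` and `e₁` to both traces cancel. What remains is the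
  -- inequality `(tr S)² ≤ 2 tr S²` for the symmetric block `S` of `A` on `e₂`, `e₃`.
  rw [LinearMap.trace_eq_matrix_trace ℝ e, LinearMap.trace_eq_matrix_trace ℝ e,
    LinearMap.toMatrix_comp e e e]
  simp only [Matrix.trace, Matrix.diag, Matrix.mul_apply, LinearMap.toMatrix_apply, he.repr_eq,
    Fin.sum_univ_four, h1, h2, h3]
  simp
  simp only [h2]
  nlinarith [sq_nonneg (q (A (e 2)) (e 2) - q (A (e 3)) (e 3)), sq_nonneg (q (A (e 3)) (e 2))]

/-- A 2-form annihilated by the null vector `k` that does not vanish on `k^⊥` is nondegenerate on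
the plane `k^⊥/k`. -/
lemma exists_smul_of_forall_eq_zero {q : E →L[ℝ] E →L[ℝ] ℝ} {b : Module.Basis (Fin 4) ℝ E}
    (hb : IsLorentzBasis q b) {k : E} (hk : k ≠ 0) (hq : q k k = 0) {β : E →L[ℝ] E →L[ℝ] ℝ}
    (halt : ∀ u v, β u v = - β v u) (hβk : ∀ v, β k v = 0)
    {u₀ v₀ : E} (hu₀ : q k u₀ = 0) (hv₀ : q k v₀ = 0) (hβ : β u₀ v₀ ≠ 0)
    {v : E} (hv : q k v = 0) (hβv : ∀ w, q k w = 0 → β v w = 0) : ∃ r : ℝ, v = r • k := by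
  obtain ⟨e, c, he, hc, rfl⟩ := exists_adapted_basis hb hk hq
  have hg : ∀ i j : Fin 4, q (e i) (e j) = if i = j then (if (i : ℕ) = 0 then -1 else 1) else 0 :=
    he
  -- Every vector of `k^⊥` is a combination of `k`, `e₂` and `e₃`.
  have hdec : ∀ w, q (c • (e 0 + e 1)) w = 0 →
      ∃ r s t : ℝ, w = r • (c • (e 0 + e 1)) + s • e 2 + t • e 3 := by
    intro w hw
    have h1 : w = e.repr w 0 • e 0 + e.repr w 1 • e 1 + e.repr w 2 • e 2 + e.repr w 3 • e 3 := by
      rw [← Fin.sum_univ_four (f := fun i => e.repr w i • e i), e.sum_repr]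
    generalize e.repr w 0 = w0, e.repr w 1 = w1, e.repr w 2 = w2, e.repr w 3 = w3 at h1
    have h2 : w1 = w0 := by
      rw [h1] at hw
      simp [hg] at hw
      exact mul_right_cancel₀ hc (by linarith)
    exact ⟨w0 * c⁻¹, w2, w3, by
      rw [h1, h2, smul_smul, mul_assoc, inv_mul_cancel₀ hc, mul_one, smul_add]⟩
  have hk2 : q (c • (e 0 + e 1)) (e 2) = 0 := by simp [hg]
  have hk3 : q (c • (e 0 + e 1)) (e 3) = 0 := by simp [hg]
  generalize c • (e 0 + e 1) = k at *
  have h22 : β (e 2) (e 2) = 0 := by linarith [halt (e 2) (e 2)]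
  have h33 : β (e 3) (e 3) = 0 := by linarith [halt (e 3) (e 3)]
  have h32 : β (e 3) (e 2) = - β (e 2) (e 3) := halt _ _
  have hβk' : ∀ w, β w k = 0 := fun w => by rw [halt, hβk, neg_zero]
  have h23 : β (e 2) (e 3) ≠ 0 := by
    intro h
    obtain ⟨r, s, t, rfl⟩ := hdec u₀ hu₀
    obtain ⟨r', s', t', rfl⟩ := hdec v₀ hv₀
    simp [h22, h33, h32, hβk, hβk', h] at hβ
  obtain ⟨r, s, t, rfl⟩ := hdec v hv
  have e2 := hβv _ hk2
  have e3 := hβv _ hk3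
  simp [h22, h33, h32, hβk, h23] at e2 e3
  exact ⟨r, by simp [e2, e3]⟩

end NullVector

/-! ### Null geodesic congruences in coordinates -/

section Congruence

variable {E : Type*} [NormedAddCommGroup E] [NormedSpace ℝ E]
  {G : E → E →L[ℝ] E →L[ℝ] ℝ} {k : E → E} {y : E}

lemma hasFDerivAt_lower (hG : DifferentiableAt ℝ G y) (hk : DifferentiableAt ℝ k y) :
    HasFDerivAt (fun y' => G y' (k y'))
      ((G y).comp (fderiv ℝ k y) + (fderiv ℝ G y).flip (k y)) y :=
  hG.hasFDerivAt.clm_apply hk.hasFDerivAt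

/-- The exterior derivative of `g(K, ·)` is the antisymmetric part of `∇K`. -/
lemma curl_lower (hG : DifferentiableAt ℝ G y) (hs : ∀ᶠ y' in 𝓝 y, ∀ u v, G y' u v = G y' v u)
    (hGi : (G y).IsInvertible) (hk : DifferentiableAt ℝ k y) (u v : E) :
    curl (fun y' => G y' (k y')) y u v =
      G y (coordCovDeriv G k y u) v - G y (coordCovDeriv G k y v) u := by
  rw [curl_apply, (hasFDerivAt_lower hG hk).fderiv]
  simp only [coordCovDeriv, add_apply, map_add, metric_coordChristoffel hGi]
  simp
  rw [fderiv_metric_symm hG hs (k y) v u]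
  ring

/-- If `g(K, K)` is constant, then `∇K` takes values in `K^⊥`. -/
lemma metric_coordCovDeriv_self (hG : DifferentiableAt ℝ G y)
    (hs : ∀ᶠ y' in 𝓝 y, ∀ u v, G y' u v = G y' v u)
    (hGi : (G y).IsInvertible) (hk : DifferentiableAt ℝ k y)
    (hnull : ∀ᶠ y' in 𝓝 y, G y' (k y') (k y') = 0) (v : E) :
    G y (coordCovDeriv G k y v) (k y) = 0 := by
  have h0 : (fun _ => (0 : ℝ)) =ᶠ[𝓝 y] fun y' => G y' (k y') (k y') :=
    hnull.mono fun y' h => h.symm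
  have h := h0.fderiv_eq (𝕜 := ℝ)
  rw [((hasFDerivAt_lower hG hk).clm_apply hk.hasFDerivAt).fderiv] at h
  have h1 := DFunLike.congr_fun h v
  simp at h1
  rw [hs.self_of_nhds] at h1
  simp only [coordCovDeriv, add_apply, map_add, metric_coordChristoffel hGi]
  rw [fderiv_metric_symm hG hs (k y) v (k y)]
  linarith

/-- If `k` is geodesic and null, then `i_k da = 0` for `a = G(k, ·)`. -/
lemma curl_lower_self (hG : DifferentiableAt ℝ G y)
    (hs : ∀ᶠ y' in 𝓝 y, ∀ u v, G y' u v = G y' v u)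
    (hGi : (G y).IsInvertible) (hk : DifferentiableAt ℝ k y)
    (hnull : ∀ᶠ y' in 𝓝 y, G y' (k y') (k y') = 0)
    (hgeod : coordCovDeriv G k y (k y) = 0) :
    curl (fun y' => G y' (k y')) y (k y) = 0 := by
  ext v
  rw [curl_lower hG hs hGi hk, hgeod, metric_coordCovDeriv_self hG hs hGi hk hnull]
  simp

end Congruence

/-! ### Propagation of the twist -/

section Twist

/-- The 3-form `a ∧ β` built from a 1-form and a 2-form. -/
def wedgeOneTwo {E : Type*} [NormedAddCommGroup E] [NormedSpace ℝ E]
    (a : E →L[ℝ] ℝ) (β : E →L[ℝ] E →L[ℝ] ℝ) (u v w : E) : ℝ :=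
  a u * β v w + a v * β w u + a w * β u v

lemma wedgeOneTwo_eq_zero_iff {E : Type*} [NormedAddCommGroup E] [NormedSpace ℝ E]
    {a : E →L[ℝ] ℝ} (ha : a ≠ 0) {β : E →L[ℝ] E →L[ℝ] ℝ} (hβ : ∀ u v, β u v = - β v u) :
    (∀ u v w, wedgeOneTwo a β u v w = 0) ↔ ∀ u v, a u = 0 → a v = 0 → β u v = 0 := by
  constructor
  · intro h u v hu hv
    obtain ⟨w, hw⟩ : ∃ w, a w ≠ 0 := by
      by_contra! hc
      exact ha (ContinuousLinearMap.ext hc)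
    have := h u v w
    simpa [wedgeOneTwo, hu, hv, hw] using this
  · intro h u v w
    obtain ⟨z, hz⟩ : ∃ z, a z ≠ 0 := by
      by_contra! hc
      exact ha (ContinuousLinearMap.ext hc)
    -- Replace each vector by its projection to `ker a` along `z`.
    have key : ∀ p q, a z ^ 2 * β p q = a z * a q * β p z + a z * a p * β z q := by
      intro p q
      have h1 := h (a z • p - a p • z) (a z • q - a q • z) (by simp; ring) (by simp; ring)
      have h2 : β z z = 0 := by linarith [hβ z z]
      simp [h2] at h1
      linarith
    have h3 : a z ^ 2 * wedgeOneTwo a β u v w = 0 := by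
      have e1 := key u v
      have e2 := key v w
      have e3 := key w u
      rw [hβ z v] at e1
      rw [hβ z w] at e2
      rw [hβ z u] at e3
      simp only [wedgeOneTwo]
      linear_combination a w * e1 + a u * e2 + a v * e3
    exact (mul_eq_zero.1 h3).resolve_left (pow_ne_zero 2 hz)

variable {n : ℕ}

lemma sum_smul_single (x : RSpace n) : x = ∑ l, x l • EuclideanSpace.single l (1 : ℝ) := by
  ext i
  simp [Finset.sum_apply, Pi.single_apply]

/-- Let `k` satisfy `a(k) = 0` and `i_k da = 0`. Then `a ∧ da` is invariant under the flow of `k`;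
if it vanishes at one point of an integral curve, it vanishes at all nearby points. -/
lemma wedge_curl_propagates {a : RSpace n → RSpace n →L[ℝ] ℝ} {k : RSpace n → RSpace n}
    {γ : ℝ → RSpace n} {t₀ : ℝ} (ha : ∀ᶠ y in 𝓝 (γ t₀), ContDiffAt ℝ 2 a y)
    (hk : ∀ᶠ y in 𝓝 (γ t₀), DifferentiableAt ℝ k y) (hkc : ContinuousAt (fderiv ℝ k) (γ t₀))
    (hak : ∀ᶠ y in 𝓝 (γ t₀), a y (k y) = 0) (hck : ∀ᶠ y in 𝓝 (γ t₀), curl a y (k y) = 0)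
    (hγ : ∀ᶠ t in 𝓝 t₀, HasDerivAt γ (k (γ t)) t) :
    ∃ ε > 0, ∀ s ∈ Ioo (t₀ - ε) (t₀ + ε), ∀ t ∈ Ioo (t₀ - ε) (t₀ + ε),
      (∀ u v w, wedgeOneTwo (a (γ s)) (curl a (γ s)) u v w = 0) →
      ∀ u v w, wedgeOneTwo (a (γ t)) (curl a (γ t)) u v w = 0 := by
  have hγc : ContinuousAt γ t₀ := hγ.self_of_nhds.continuousAt
  have hM : ∀ᶠ y in 𝓝 (γ t₀), ‖fderiv ℝ k y‖ < ‖fderiv ℝ k (γ t₀)‖ + 1 :=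
    hkc.norm.eventually (Iio_mem_nhds (lt_add_one _))
  set M : ℝ := ‖fderiv ℝ k (γ t₀)‖ + 1 with hMdef
  have hM0 : 0 ≤ M := by positivity
  have hall := hγ.and (hγc.eventually (ha.and (hk.and (hM.and
    (hak.eventually_nhds.and hck.eventually_nhds)))))
  obtain ⟨ε, hε, hball⟩ := Metric.eventually_nhds_iff.1 hall
  refine ⟨ε, hε, fun s hs t ht h0 => ?_⟩
  -- The components `c` of `a ∧ da` along the curve solve the linear equation `c' = V(t, c)`, and
  -- so does zero.
  let e : Fin n → RSpace n := fun i => EuclideanSpace.single i (1 : ℝ)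
  let c : ℝ → (Fin n × Fin n × Fin n → ℝ) := fun t p =>
    wedgeOneTwo (a (γ t)) (curl a (γ t)) (e p.1) (e p.2.1) (e p.2.2)
  let m : ℝ → Fin n → Fin n → ℝ := fun t l i => fderiv ℝ k (γ t) (e i) l
  let V : ℝ → (Fin n × Fin n × Fin n → ℝ) → (Fin n × Fin n × Fin n → ℝ) := fun t c p =>
    -∑ l, (m t l p.1 * c (l, p.2.1, p.2.2) + m t l p.2.1 * c (p.1, l, p.2.2)
      + m t l p.2.2 * c (p.1, p.2.1, l))
  have hmem : ∀ t ∈ Ioo (t₀ - ε) (t₀ + ε), dist t t₀ < ε := by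
    intro t ht
    rw [Real.dist_eq, abs_lt]
    constructor <;> linarith [ht.1, ht.2]
  have hm : ∀ t ∈ Ioo (t₀ - ε) (t₀ + ε), ∀ l i, |m t l i| ≤ M := by
    intro t ht l i
    obtain ⟨-, -, -, h, -⟩ := hball (hmem t ht)
    calc |m t l i| ≤ ‖fderiv ℝ k (γ t) (e i)‖ := PiLp.norm_apply_le (fderiv ℝ k (γ t) (e i)) l
      _ ≤ ‖fderiv ℝ k (γ t)‖ * ‖e i‖ := ContinuousLinearMap.le_opNorm _ _
      _ ≤ M := by simp [e]; exact h.le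
  have hLip : ∀ t ∈ Ioo (t₀ - ε) (t₀ + ε),
      LipschitzOnWith (Real.toNNReal (n * (3 * M))) (V t) univ := by
    intro t ht
    refine (LipschitzWith.of_dist_le_mul fun c₁ c₂ => ?_).lipschitzOnWith
    rw [Real.coe_toNNReal _ (by positivity), dist_pi_le_iff (by positivity)]
    intro p
    have hd : ∀ q, |c₁ q - c₂ q| ≤ dist c₁ c₂ := fun q => dist_le_pi_dist c₁ c₂ q
    have hmd : ∀ l i q, |m t l i * (c₁ q - c₂ q)| ≤ M * dist c₁ c₂ := fun l i q => by
      rw [abs_mul]; exact mul_le_mul (hm t ht l i) (hd q) (abs_nonneg _) hM0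
    rw [Real.dist_eq]
    simp only [V]
    rw [← abs_neg, neg_sub_neg, neg_sub, ← Finset.sum_sub_distrib]
    calc _ ≤ ∑ l : Fin n, 3 * (M * dist c₁ c₂) := by
          refine (Finset.abs_sum_le_sum_abs _ _).trans (Finset.sum_le_sum fun l _ => ?_)
          have h1 := hmd l p.1 (l, p.2.1, p.2.2)
          have h2 := hmd l p.2.1 (p.1, l, p.2.2)
          have h3 := hmd l p.2.2 (p.1, p.2.1, l)
          rw [abs_le] at *
          constructor <;> nlinarith
      _ = _ := by simp; ring
  have hder : ∀ t ∈ Ioo (t₀ - ε) (t₀ + ε), HasDerivAt c (V t (c t)) t := by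
    intro t ht
    obtain ⟨hγt, hat, hkt, -, hakt, hckt⟩ := hball (hmem t ht)
    have ha1 : DifferentiableAt ℝ a (γ t) := hat.differentiableAt two_ne_zero
    have hca := differentiableAt_curl hat
    -- `𝓛_k a = 0` and `𝓛_k da = 0`
    have hLa : ∀ v, fderiv ℝ a (γ t) (k (γ t)) v = - a (γ t) (fderiv ℝ k (γ t) v) := by
      intro v
      have h0 : (fun _ => (0 : ℝ)) =ᶠ[𝓝 (γ t)] fun y' => a y' (k y') :=
        hakt.mono fun y' h => h.symm
      have h1 := h0.fderiv_eq (𝕜 := ℝ)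
      rw [(ha1.hasFDerivAt.clm_apply hkt.hasFDerivAt).fderiv] at h1
      have h2 := DFunLike.congr_fun h1 v
      have h3 := DFunLike.congr_fun hckt.self_of_nhds v
      rw [curl_apply] at h3
      simp at h2 h3
      linarith
    have hLc : ∀ u v, fderiv ℝ (curl a) (γ t) (k (γ t)) u v =
        - curl a (γ t) (fderiv ℝ k (γ t) u) v - curl a (γ t) u (fderiv ℝ k (γ t) v) := by
      intro u v
      have := lieDeriv_curl (t := fun _ => 0) hat hkt hckt u v
      have h0 : curl (fun _ => (0 : RSpace n →L[ℝ] ℝ)) (γ t) u v = 0 := by simp [curl_apply]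
      rw [h0] at this
      linarith
    have hda : ∀ u, HasDerivAt (fun t => a (γ t) u) (- a (γ t) (fderiv ℝ k (γ t) u)) t := by
      intro u
      have h1 : HasDerivAt (fun t => a (γ t)) (fderiv ℝ a (γ t) (k (γ t))) t :=
        HasFDerivAt.comp_hasDerivAt t ha1.hasFDerivAt hγt
      have h2 := h1.clm_apply (hasDerivAt_const t u)
      simpa [hLa] using h2
    have hdc : ∀ u v, HasDerivAt (fun t => curl a (γ t) u v)
        (- curl a (γ t) (fderiv ℝ k (γ t) u) v - curl a (γ t) u (fderiv ℝ k (γ t) v)) t := by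
      intro u v
      have h1 : HasDerivAt (fun t => curl a (γ t)) (fderiv ℝ (curl a) (γ t) (k (γ t))) t :=
        HasFDerivAt.comp_hasDerivAt (𝕜 := ℝ) (E := RSpace n →L[ℝ] RSpace n →L[ℝ] ℝ)
          (l := curl a) (f := γ) t hca.hasFDerivAt hγt
      have h2 := (h1.clm_apply (hasDerivAt_const t u)).clm_apply (hasDerivAt_const t v)
      simpa [hLc] using h2
    rw [hasDerivAt_pi]
    rintro ⟨i, j, l⟩
    have h := (((hda (e i)).mul (hdc (e j) (e l))).add ((hda (e j)).mul (hdc (e l) (e i)))).add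
      ((hda (e l)).mul (hdc (e i) (e j)))
    refine h.congr_deriv ?_
    have hexp : ∀ i, fderiv ℝ k (γ t) (e i) = ∑ q, m t q i • e q := fun i => sum_smul_single _
    simp only [hexp, map_sum, map_smul, sum_apply, smul_apply, smul_eq_mul, V, c, wedgeOneTwo,
      Finset.mul_sum, Finset.sum_mul, ← Finset.sum_neg_distrib, ← Finset.sum_add_distrib,
      ← Finset.sum_sub_distrib]
    refine Finset.sum_congr rfl fun q _ => ?_
    ring
  have hzero : ∀ t ∈ Ioo (t₀ - ε) (t₀ + ε),
      HasDerivAt (fun _ => (0 : Fin n × Fin n × Fin n → ℝ)) (V t 0) t := by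
    intro t _
    have : V t 0 = 0 := by ext p; simp [V]
    rw [this]; exact hasDerivAt_const _ _
  have hEq := ODE_solution_unique_of_mem_Ioo (s := fun _ => univ) hLip hs
    (fun t ht => ⟨hder t ht, mem_univ _⟩) (fun t ht => ⟨hzero t ht, mem_univ _⟩)
    (by ext p; exact h0 _ _ _)
  have hct := hEq ht
  intro u v w
  have hc0 : ∀ i j l, wedgeOneTwo (a (γ t)) (curl a (γ t)) (e i) (e j) (e l) = 0 :=
    fun i j l => congr_fun hct (i, j, l)
  have l1 : ∀ i j w, wedgeOneTwo (a (γ t)) (curl a (γ t)) (e i) (e j) w = 0 := by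
    intro i j w
    have : wedgeOneTwo (a (γ t)) (curl a (γ t)) (e i) (e j) w =
        ∑ q, w q * wedgeOneTwo (a (γ t)) (curl a (γ t)) (e i) (e j) (e q) := by
      conv_lhs => rw [sum_smul_single w]
      simp only [map_sum, map_smul, sum_apply, smul_apply, smul_eq_mul, wedgeOneTwo,
        Finset.mul_sum, Finset.sum_mul, ← Finset.sum_add_distrib, e]
      exact Finset.sum_congr rfl fun q _ => by ring
    simp [this, hc0]
  have l2 : ∀ i v w, wedgeOneTwo (a (γ t)) (curl a (γ t)) (e i) v w = 0 := by
    intro i v w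
    have : wedgeOneTwo (a (γ t)) (curl a (γ t)) (e i) v w =
        ∑ q, v q * wedgeOneTwo (a (γ t)) (curl a (γ t)) (e i) (e q) w := by
      conv_lhs => rw [sum_smul_single v]
      simp only [map_sum, map_smul, sum_apply, smul_apply, smul_eq_mul, wedgeOneTwo,
        Finset.mul_sum, Finset.sum_mul, ← Finset.sum_add_distrib, e]
      exact Finset.sum_congr rfl fun q _ => by ring
    simp [this, l1]
  have : wedgeOneTwo (a (γ t)) (curl a (γ t)) u v w =
      ∑ q, u q * wedgeOneTwo (a (γ t)) (curl a (γ t)) (e q) v w := by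
    conv_lhs => rw [sum_smul_single u]
    simp only [map_sum, map_smul, sum_apply, smul_apply, smul_eq_mul, wedgeOneTwo,
      Finset.mul_sum, Finset.sum_mul, ← Finset.sum_add_distrib, e]
    exact Finset.sum_congr rfl fun q _ => by ring
  simp [this, l2]

end Twist

/-! ### The Riccati inequality -/

/-- There is no function on the whole line with `θ' < -θ²/2`. -/
lemma not_forall_riccati_lt {θ θ' : ℝ → ℝ} (hθ : ∀ t, HasDerivAt θ (θ' t) t)
    (hlt : ∀ t, θ' t < - θ t ^ 2 / 2) : False := by
  have main : ∀ {θ θ' : ℝ → ℝ}, (∀ t, HasDerivAt θ (θ' t) t) → (∀ t, θ' t < - θ t ^ 2 / 2) →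
      ∀ t₀, ¬ θ t₀ < 0 := by
    intro θ θ' hθ hlt t₀ h0
    have hanti : Antitone θ := antitone_of_deriv_nonpos (fun t => (hθ t).differentiableAt)
      fun t => by rw [(hθ t).deriv]; nlinarith [hlt t, sq_nonneg (θ t)]
    have hneg : ∀ t, t₀ ≤ t → θ t < 0 := fun t ht => (hanti ht).trans_lt h0
    -- `1/θ` grows at least at rate `1/2`, so it would become positive.
    have hmono : MonotoneOn (fun t => (θ t)⁻¹ - t / 2) (Ici t₀) := by
      have hd : ∀ t ∈ Ici t₀, HasDerivAt (fun t => (θ t)⁻¹ - t / 2) (-θ' t / θ t ^ 2 - 1 / 2) t :=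
        fun t ht => ((hθ t).inv (hneg t ht).ne).sub ((hasDerivAt_id t).div_const 2)
      refine monotoneOn_of_deriv_nonneg (convex_Ici _)
        (fun t ht => (hd t ht).continuousAt.continuousWithinAt)
        (fun t ht => (hd t (interior_subset ht)).differentiableAt.differentiableWithinAt)
        fun t ht => ?_
      rw [(hd t (interior_subset ht)).deriv, sub_nonneg,
        le_div_iff₀ (sq_pos_of_neg (hneg t (interior_subset ht)))]
      linarith [hlt t]
    have ht1 : t₀ ≤ t₀ - 2 * (θ t₀)⁻¹ := by linarith [inv_lt_zero.2 h0]
    have h1 := hmono (mem_Ici.2 le_rfl) (mem_Ici.2 ht1) ht1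
    simp only at h1
    have h2 := inv_lt_zero.2 (hneg _ ht1)
    linarith
  -- Both `θ` and its reversal `t ↦ -θ(-t)` satisfy the inequality, so `θ` would vanish.
  have hnonneg := fun t => not_lt.1 (main hθ hlt t)
  have hrev := fun t => not_lt.1 (main (θ := fun t => - θ (-t)) (θ' := fun t => θ' (-t))
    (fun t => by
      have := ((hθ (-t)).scomp t (hasDerivAt_neg t)).neg
      simp only [smul_eq_mul, neg_mul, one_mul, neg_neg] at this
      exact this) (fun t => by simpa using hlt (-t)) t)
  have hz : ∀ t, θ t = 0 := fun t => le_antisymm (by simpa using hrev (-t)) (hnonneg t)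
  have h1 : θ = fun _ => 0 := funext hz
  have h2 := (hθ 0).unique (by rw [h1]; exact hasDerivAt_const _ _)
  have h3 := hlt 0
  rw [h2, hz] at h3
  norm_num at h3

/-! ### Raychaudhuri's equation -/

section Raychaudhuri

-- The derivative of `G` takes values in trilinear forms, whose nested normed structures are found
-- only with a larger search depth.
set_option maxSynthPendingDepth 6 in
lemma differentiableAt_coordCovDeriv {E : Type*} [NormedAddCommGroup E] [NormedSpace ℝ E]
    [CompleteSpace E] {G : E → E →L[ℝ] E →L[ℝ] ℝ} {k : E → E} {y : E}
    (hG : ContDiffAt ℝ 2 G y) (hGi : (G y).IsInvertible) (hk : ContDiffAt ℝ 2 k y) :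
    DifferentiableAt ℝ (coordCovDeriv G k) y := by
  have hG1 : DifferentiableAt ℝ G y := hG.differentiableAt two_ne_zero
  have hG2 : DifferentiableAt ℝ (fderiv ℝ G) y :=
    (ContDiffAt.fderiv_right (F := E →L[ℝ] E →L[ℝ] ℝ) (m := 1) hG
      (by norm_num)).differentiableAt one_ne_zero
  have hk1 : DifferentiableAt ℝ k y := hk.differentiableAt two_ne_zero
  have hk2 : DifferentiableAt ℝ (fderiv ℝ k) y :=
    (hk.fderiv_right (m := 1) (by norm_num)).differentiableAt one_ne_zero
  have hinv : DifferentiableAt ℝ (fun y' => (G y').inverse) y := by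
    obtain ⟨e, he⟩ := hGi
    have h1 : DifferentiableAt ℝ
        (ContinuousLinearMap.inverse : (E →L[ℝ] E →L[ℝ] ℝ) → (E →L[ℝ] ℝ) →L[ℝ] E) (G y) := by
      rw [← he]
      exact (contDiffAt_map_inverse (𝕜 := ℝ) (n := 1) e).differentiableAt one_ne_zero
    exact DifferentiableAt.comp (𝕜 := ℝ) (F := E →L[ℝ] E →L[ℝ] ℝ) (G := (E →L[ℝ] ℝ) →L[ℝ] E)
      (g := ContinuousLinearMap.inverse) (f := G) y h1 hG1
  have hflip0 : DifferentiableAt ℝ (fun y' => (fderiv ℝ G y').flip) y :=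
    DifferentiableAt.clm_flip (F := E) (H := E) (W := E →L[ℝ] ℝ) hG2
  have hflip : DifferentiableAt ℝ (fun y' => (fderiv ℝ G y').flip (k y')) y :=
    DifferentiableAt.clm_apply (𝕜 := ℝ) (G := E) (H := E →L[ℝ] E →L[ℝ] ℝ)
      (c := fun y' => (fderiv ℝ G y').flip) (u := k) hflip0 hk1
  have hS : DifferentiableAt ℝ (fun y' => (fderiv ℝ G y').flip (k y') + fderiv ℝ G y' (k y') -
      ((fderiv ℝ G y').flip (k y')).flip) y :=
    DifferentiableAt.fun_sub (𝕜 := ℝ) (F := E →L[ℝ] E →L[ℝ] ℝ)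
      (DifferentiableAt.fun_add (𝕜 := ℝ) (F := E →L[ℝ] E →L[ℝ] ℝ) hflip
        (DifferentiableAt.clm_apply (𝕜 := ℝ) (H := E →L[ℝ] E →L[ℝ] ℝ) hG2 hk1))
      (DifferentiableAt.clm_flip (F := E) (H := E) (W := ℝ) hflip)
  exact hk2.add ((hinv.clm_comp hS).const_smul (1 / 2 : ℝ))

variable {n : ℕ} {G : RSpace n → RSpace n →L[ℝ] RSpace n →L[ℝ] ℝ} {k : RSpace n → RSpace n}
  {y : RSpace n}

lemma trace_eq_sum_single (A : RSpace n →ₗ[ℝ] RSpace n) :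
    LinearMap.trace ℝ (RSpace n) A = ∑ i, A (EuclideanSpace.single i 1) i := by
  rw [LinearMap.trace_eq_matrix_trace ℝ (EuclideanSpace.basisFun (Fin n) ℝ).toBasis]
  simp [Matrix.trace, LinearMap.toMatrix_apply]

/-- The trace of the covariant derivative of `k`, i.e. its divergence. -/
def coordDiv (G : RSpace n → RSpace n →L[ℝ] RSpace n →L[ℝ] ℝ) (k : RSpace n → RSpace n)
    (y : RSpace n) : ℝ :=
  LinearMap.trace ℝ (RSpace n) (coordCovDeriv G k y)

lemma coordDiv_eq_sum (y : RSpace n) :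
    coordDiv G k y = ∑ i, coordCovDeriv G k y (EuclideanSpace.single i 1) i :=
  trace_eq_sum_single _

lemma hasFDerivAt_coordCovDeriv_single (hB : DifferentiableAt ℝ (coordCovDeriv G k) y) (i : Fin n) :
    HasFDerivAt (fun y' => coordCovDeriv G k y' (EuclideanSpace.single i 1) i)
      ((EuclideanSpace.proj i : RSpace n →L[ℝ] ℝ).comp
        (fderiv ℝ (fun y' => coordCovDeriv G k y' (EuclideanSpace.single i 1)) y)) y :=
  HasFDerivAt.comp (𝕜 := ℝ) (g := (EuclideanSpace.proj i : RSpace n →L[ℝ] ℝ))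
    (f := fun y' => coordCovDeriv G k y' (EuclideanSpace.single i 1)) y
    (EuclideanSpace.proj i : RSpace n →L[ℝ] ℝ).hasFDerivAt
    (hB.clm_apply (differentiableAt_const _)).hasFDerivAt

lemma differentiableAt_coordDiv (hB : DifferentiableAt ℝ (coordCovDeriv G k) y) :
    DifferentiableAt ℝ (coordDiv G k) y := by
  have : coordDiv G k =
      fun y' => ∑ i, coordCovDeriv G k y' (EuclideanSpace.single i 1) i :=
    funext coordDiv_eq_sum
  rw [this]
  exact DifferentiableAt.fun_sum fun i _ => (hasFDerivAt_coordCovDeriv_single hB i).differentiableAt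

/-- Raychaudhuri's equation for a geodesic field: the left-hand side is the Ricci curvature
`∑ᵢ dxⁱ(R(∂ᵢ, k)k)`, where the term `∇_{∂ᵢ}∇_k k` has been dropped. -/
lemma coord_raychaudhuri (hs : ∀ᶠ y' in 𝓝 y, ∀ u v, G y' u v = G y' v u)
    (hG : DifferentiableAt ℝ G y) (hGi : (G y).IsInvertible)
    (hB : DifferentiableAt ℝ (coordCovDeriv G k) y) :
    ∑ i, (- coordCovDeriv G (fun y' => coordCovDeriv G k y' (EuclideanSpace.single i 1)) y (k y)
        - coordCovDeriv G k y (fderiv ℝ k y (EuclideanSpace.single i 1))) i =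
      - fderiv ℝ (coordDiv G k) y (k y) -
        LinearMap.trace ℝ (RSpace n)
          ((coordCovDeriv G k y : RSpace n →ₗ[ℝ] RSpace n) ∘ₗ (coordCovDeriv G k y)) := by
  have h1 : fderiv ℝ (coordDiv G k) y (k y) =
      ∑ i, fderiv ℝ (fun y' => coordCovDeriv G k y' (EuclideanSpace.single i 1)) y (k y) i := by
    have : coordDiv G k =
        fun y' => ∑ i, coordCovDeriv G k y' (EuclideanSpace.single i 1) i :=
      funext coordDiv_eq_sum
    rw [this, fderiv_fun_sum fun i _ => (hasFDerivAt_coordCovDeriv_single hB i).differentiableAt,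
      sum_apply]
    refine Finset.sum_congr rfl fun i _ => ?_
    rw [(hasFDerivAt_coordCovDeriv_single hB i).fderiv]
    rfl
  set B := coordCovDeriv G k y with hBdef
  set Γ := coordChristoffel G y (k y) with hΓ
  have h2 : ∑ i, Γ (B (EuclideanSpace.single i 1)) i =
      ∑ i, B (Γ (EuclideanSpace.single i 1)) i := by
    have := LinearMap.trace_mul_comm ℝ (Γ : RSpace n →ₗ[ℝ] RSpace n) (B : RSpace n →ₗ[ℝ] RSpace n)
    rw [trace_eq_sum_single, trace_eq_sum_single] at this
    exact this
  have h3 : ∀ i, coordCovDeriv G (fun y' => coordCovDeriv G k y' (EuclideanSpace.single i 1)) y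
      (k y) = fderiv ℝ (fun y' => coordCovDeriv G k y' (EuclideanSpace.single i 1)) y (k y) +
        Γ (B (EuclideanSpace.single i 1)) := by
    intro i
    rw [coordCovDeriv, add_apply, coordChristoffel_symm hG hs hGi]
  have h4 : ∀ i, B (B (EuclideanSpace.single i 1)) =
      B (fderiv ℝ k y (EuclideanSpace.single i 1)) + B (Γ (EuclideanSpace.single i 1)) := by
    intro i
    rw [← map_add]; rfl
  rw [h1, trace_eq_sum_single]
  simp only [LinearMap.comp_apply, ContinuousLinearMap.coe_coe, h3, h4, PiLp.sub_apply,
    PiLp.neg_apply, PiLp.add_apply, Finset.sum_add_distrib, Finset.sum_sub_distrib,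
    Finset.sum_neg_distrib, h2]
  ring

end Raychaudhuri

/-! ### Charts, and the coordinate expressions of vector fields, metrics and forms -/

section Charts

variable {n k : ℕ} {M : Type*} [TopologicalSpace M] [ChartedSpace (RSpace n) M]

/-- The coordinate expression of a vector field in the chart centred at `x₀`. -/
def vecInChart (Y : VField n M) (x₀ : M) (y : RSpace n) : RSpace n :=
  chartDeriv x₀ ((extChartAt (𝓡 n) x₀).symm y) (Y ((extChartAt (𝓡 n) x₀).symm y))

variable {x₀ x₁ p : M} {y : RSpace n}

lemma vecInChart_extChartAt (Y : VField n M) (hp : p ∈ (extChartAt (𝓡 n) x₀).source) :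
    vecInChart Y x₀ (extChartAt (𝓡 n) x₀ p) = chartDeriv x₀ p (Y p) := by
  rw [vecInChart, (extChartAt (𝓡 n) x₀).left_inv hp]

/-- The coordinate change between the charts centred at `x₀` and `x₁`. -/
def chartChange (x₀ x₁ : M) : RSpace n → RSpace n :=
  extChartAt (𝓡 n) x₁ ∘ (extChartAt (𝓡 n) x₀).symm

lemma chartChange_extChartAt (hp : p ∈ (extChartAt (𝓡 n) x₀).source) :
    chartChange x₀ x₁ (extChartAt (𝓡 n) x₀ p) = extChartAt (𝓡 n) x₁ p := by
  rw [chartChange, Function.comp_apply, (extChartAt (𝓡 n) x₀).left_inv hp]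

/-- Testing an identity near `extChartAt p` on the manifold. -/
lemma eventually_nhds_extChartAt {P : RSpace n → Prop} (hp : p ∈ (extChartAt (𝓡 n) x₀).source)
    (h : ∀ q ∈ (extChartAt (𝓡 n) x₀).source, P (extChartAt (𝓡 n) x₀ q)) :
    ∀ᶠ y in 𝓝 (extChartAt (𝓡 n) x₀ p), P y := by
  filter_upwards [(isOpen_extChartAt_target x₀).mem_nhds ((extChartAt (𝓡 n) x₀).map_source hp)]
    with y hy
  rw [← (extChartAt (𝓡 n) x₀).right_inv hy]
  exact h _ ((extChartAt (𝓡 n) x₀).map_target hy)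

variable [IsManifold (𝓡 n) ∞ M]

lemma isInvertible_chartDeriv (hp : p ∈ (extChartAt (𝓡 n) x₀).source) :
    (chartDeriv (n := n) x₀ p).IsInvertible :=
  have : IsManifold (𝓡 n) 1 M := IsManifold.of_le (n := ∞) (by simp)
  isInvertible_mfderiv_extChartAt hp

lemma chartInvDeriv_eq (hy : y ∈ (extChartAt (𝓡 n) x₀).target) :
    chartInvDeriv x₀ y = (chartDeriv x₀ ((extChartAt (𝓡 n) x₀).symm y)).inverse := by
  have : IsManifold (𝓡 n) 1 M := IsManifold.of_le (n := ∞) (by simp)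
  have h1 := mfderivWithin_extChartAt_symm_comp_mfderiv_extChartAt hy
  have h2 := mfderiv_extChartAt_comp_mfderivWithin_extChartAt_symm hy
  rw [ModelWithCorners.range_eq_univ, mfderivWithin_univ] at h1 h2
  exact (ContinuousLinearMap.inverse_eq h2 h1).symm

lemma inChart_extChartAt (η : DForm n k M) (hp : p ∈ (extChartAt (𝓡 n) x₀).source) :
    DForm.inChart η x₀ (extChartAt (𝓡 n) x₀ p) =
      (η p).compContinuousLinearMap (chartDeriv x₀ p).inverse := by
  rw [DForm.inChart, chartInvDeriv_eq ((extChartAt (𝓡 n) x₀).map_source hp),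
    (extChartAt (𝓡 n) x₀).left_inv hp]

lemma metric_inChart_extChartAt (g : LorentzMetric n M) (hp : p ∈ (extChartAt (𝓡 n) x₀).source)
    (u v : RSpace n) :
    g.inChart x₀ (extChartAt (𝓡 n) x₀ p) u v =
      g.val p ((chartDeriv x₀ p).inverse u) ((chartDeriv x₀ p).inverse v) := by
  have h : g.inChart x₀ (extChartAt (𝓡 n) x₀ p) u v =
    g.val ((extChartAt (𝓡 n) x₀).symm (extChartAt (𝓡 n) x₀ p))
      (chartInvDeriv x₀ (extChartAt (𝓡 n) x₀ p) u) (chartInvDeriv x₀ (extChartAt (𝓡 n) x₀ p) v) :=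
    rfl
  rw [h, chartInvDeriv_eq ((extChartAt (𝓡 n) x₀).map_source hp),
    (extChartAt (𝓡 n) x₀).left_inv hp]

lemma metric_inChart_chartDeriv (g : LorentzMetric n M) (hp : p ∈ (extChartAt (𝓡 n) x₀).source)
    (u v : TangentSpace (𝓡 n) p) :
    g.inChart x₀ (extChartAt (𝓡 n) x₀ p) (chartDeriv x₀ p u) (chartDeriv x₀ p v) =
      g.val p u v := by
  rw [metric_inChart_extChartAt g hp, (isInvertible_chartDeriv hp).inverse_apply_self,
    (isInvertible_chartDeriv hp).inverse_apply_self]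

lemma contDiffAt_chartChange (hp₀ : p ∈ (extChartAt (𝓡 n) x₀).source)
    (hp₁ : p ∈ (extChartAt (𝓡 n) x₁).source) :
    ContDiffAt ℝ ∞ (chartChange x₀ x₁) (extChartAt (𝓡 n) x₀ p) := by
  rw [← contDiffWithinAt_univ, ← ModelWithCorners.range_eq_univ (𝓡 n)]
  refine contDiffWithinAt_ext_coord_change (n := ∞) x₁ x₀ ?_
  rw [PartialEquiv.trans_source]
  refine ⟨(extChartAt (𝓡 n) x₀).map_source hp₀, ?_⟩
  rw [mem_preimage, (extChartAt (𝓡 n) x₀).left_inv hp₀]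
  exact hp₁

lemma chartDeriv_eq_comp (hp₀ : p ∈ (extChartAt (𝓡 n) x₀).source)
    (hp₁ : p ∈ (extChartAt (𝓡 n) x₁).source) (v : TangentSpace (𝓡 n) p) :
    chartDeriv x₁ p v =
      fderiv ℝ (chartChange x₀ x₁) (extChartAt (𝓡 n) x₀ p) (chartDeriv x₀ p v) := by
  have : IsManifold (𝓡 n) 1 M := IsManifold.of_le (n := ∞) (by simp)
  have h1 : MDifferentiableAt (𝓡 n) 𝓘(ℝ, RSpace n) (extChartAt (𝓡 n) x₀) p :=
    mdifferentiableAt_extChartAt (by simpa using hp₀)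
  have h2 : MDifferentiableAt 𝓘(ℝ, RSpace n) 𝓘(ℝ, RSpace n) (chartChange x₀ x₁)
      (extChartAt (𝓡 n) x₀ p) :=
    ((contDiffAt_chartChange hp₀ hp₁).differentiableAt (by simp)).mdifferentiableAt
  have h3 := mfderiv_comp p h2 h1
  have h4 : extChartAt (𝓡 n) x₁ =ᶠ[𝓝 p] chartChange x₀ x₁ ∘ extChartAt (𝓡 n) x₀ := by
    filter_upwards [(isOpen_extChartAt_source x₀).mem_nhds hp₀] with q hq
    rw [Function.comp_apply, chartChange_extChartAt hq]
  have h5 : chartDeriv x₁ p = mfderiv (𝓡 n) 𝓘(ℝ, RSpace n)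
      (chartChange x₀ x₁ ∘ extChartAt (𝓡 n) x₀) p := h4.mfderiv_eq
  rw [h5, h3, mfderiv_eq_fderiv]
  rfl

lemma contMDiffOn_symm (x₀ : M) : ContMDiffOn 𝓘(ℝ, RSpace n) (𝓡 n) ∞ (extChartAt (𝓡 n) x₀).symm
    (extChartAt (𝓡 n) x₀).target :=
  contMDiffOn_extChartAt_symm x₀

/-- The trivialization of the tangent bundle at `x₀` is given by the derivative of the chart. -/
lemma trivializationAt_snd (hp : p ∈ (extChartAt (𝓡 n) x₀).source) (v : TangentSpace (𝓡 n) p) :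
    (trivializationAt (RSpace n) (TangentSpace (𝓡 n)) x₀ ⟨p, v⟩).2 = chartDeriv x₀ p v := by
  have : IsManifold (𝓡 n) 1 M := IsManifold.of_le (n := ∞) (by simp)
  have hp' : p ∈ (chartAt (RSpace n) x₀).source := by simpa using hp
  have h := TangentBundle.continuousLinearMapAt_trivializationAt (I := 𝓡 n) hp'
  have h2 : p ∈ (trivializationAt (RSpace n) (TangentSpace (𝓡 n)) x₀).baseSet := by simpa using hp'
  rw [chartDeriv, ← h]
  exact (congr_fun ((trivializationAt (RSpace n) (TangentSpace (𝓡 n)) x₀).coe_linearMapAt_of_mem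
    (R := ℝ) h2) v).symm

/-- Smoothness of a vector field may be tested on its coordinates in a chart. -/
lemma contMDiffOn_section_iff_chartDeriv (Y : VField n M) (x₀ : M) :
    ContMDiffOn (𝓡 n) (𝓡 n).tangent ∞ (fun x => (⟨x, Y x⟩ : TangentBundle (𝓡 n) M))
      (extChartAt (𝓡 n) x₀).source ↔
    ContMDiffOn (𝓡 n) 𝓘(ℝ, RSpace n) ∞ (fun p => (chartDeriv x₀ p (Y p) : RSpace n))
      (extChartAt (𝓡 n) x₀).source := by
  have h := (trivializationAt (RSpace n) (TangentSpace (𝓡 n)) x₀).contMDiffOn_section_iff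
    (IB := 𝓡 n) (n := ∞) (s := Y) (isOpen_extChartAt_source (I := 𝓡 n) x₀) (by simp)
  rw [ModelWithCorners.tangent]
  refine h.trans (contMDiffOn_congr fun p hp => ?_)
  exact trivializationAt_snd hp (Y p)

lemma IsSmoothVField.contDiffOn_vecInChart {Y : VField n M} (hY : IsSmoothVField Y) (x₀ : M) :
    ContDiffOn ℝ ∞ (vecInChart Y x₀) (extChartAt (𝓡 n) x₀).target := by
  rw [← contMDiffOn_iff_contDiffOn]
  have h1 := (contMDiffOn_section_iff_chartDeriv Y x₀).1 hY.contMDiffOn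
  exact h1.comp (contMDiffOn_symm x₀) fun y hy => (extChartAt (𝓡 n) x₀).map_target hy

/-- The coordinate vector fields of a chart are smooth on its domain. -/
lemma contMDiffOn_chartDeriv_inverse (x₀ : M) (v : RSpace n) :
    ContMDiffOn (𝓡 n) (𝓡 n).tangent ∞
      (fun x => (⟨x, (chartDeriv x₀ x).inverse v⟩ : TangentBundle (𝓡 n) M))
      (extChartAt (𝓡 n) x₀).source := by
  rw [contMDiffOn_section_iff_chartDeriv (fun x => (chartDeriv x₀ x).inverse v)]
  refine (contMDiffOn_const (c := v)).congr fun p hp => ?_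
  exact (isInvertible_chartDeriv hp).self_apply_inverse v

lemma contDiffOn_metric_inChart (g : LorentzMetric n M) (x₀ : M) :
    ContDiffOn ℝ ∞ (g.inChart x₀) (extChartAt (𝓡 n) x₀).target := by
  rw [contDiffOn_clm_apply]
  intro u
  rw [contDiffOn_clm_apply]
  intro v
  rw [← contMDiffOn_iff_contDiffOn]
  have h1 : ContMDiffOn (𝓡 n) 𝓘(ℝ, ℝ) ∞
      (fun p => g.val p ((chartDeriv x₀ p).inverse u) ((chartDeriv x₀ p).inverse v))
      (extChartAt (𝓡 n) x₀).source := by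
    have h := ContMDiffOn.clm_bundle_apply₂ (F₁ := RSpace n) (F₂ := RSpace n)
      (g.contMDiff.contMDiffOn (s := (extChartAt (𝓡 n) x₀).source))
      (contMDiffOn_chartDeriv_inverse x₀ u) (contMDiffOn_chartDeriv_inverse x₀ v)
    intro p hp
    exact (Bundle.contMDiffWithinAt_totalSpace.1 (h p hp)).2
  refine (h1.comp (contMDiffOn_symm x₀) fun y hy => (extChartAt (𝓡 n) x₀).map_target hy).congr
    fun y hy => ?_
  rw [← (extChartAt (𝓡 n) x₀).right_inv hy]
  rw [metric_inChart_extChartAt g ((extChartAt (𝓡 n) x₀).map_target hy)]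
  rw [(extChartAt (𝓡 n) x₀).right_inv hy]
  rfl

end Charts

/-! ### Chart independence -/

section Naturality

variable {n k : ℕ} {M : Type*} [TopologicalSpace M] [ChartedSpace (RSpace n) M]
  {x₀ x₁ p : M}

lemma two_le_infty : (2 : WithTop ℕ∞) ≤ ∞ :=
  WithTop.coe_le_coe.2 (le_top : (2 : ℕ∞) ≤ ⊤)

lemma eventually_mem_source (hp₀ : p ∈ (extChartAt (𝓡 n) x₀).source)
    (hp₁ : p ∈ (extChartAt (𝓡 n) x₁).source) :
    ∀ᶠ y in 𝓝 (extChartAt (𝓡 n) x₀ p), ∃ q ∈ (extChartAt (𝓡 n) x₀).source,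
      q ∈ (extChartAt (𝓡 n) x₁).source ∧ extChartAt (𝓡 n) x₀ q = y := by
  have h1 := (isOpen_extChartAt_target (I := 𝓡 n) x₀).mem_nhds
    ((extChartAt (𝓡 n) x₀).map_source hp₀)
  have h2 : (extChartAt (𝓡 n) x₀).symm ⁻¹' (extChartAt (𝓡 n) x₁).source ∈
      𝓝 (extChartAt (𝓡 n) x₀ p) := by
    refine (continuousAt_extChartAt_symm' hp₀).preimage_mem_nhds ?_
    rw [(extChartAt (𝓡 n) x₀).left_inv hp₀]
    exact (isOpen_extChartAt_source x₁).mem_nhds hp₁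
  filter_upwards [h1, h2] with y hy1 hy2
  exact ⟨_, (extChartAt (𝓡 n) x₀).map_target hy1, hy2, (extChartAt (𝓡 n) x₀).right_inv hy1⟩

lemma DForm.IsSmooth.contDiffAt {η : DForm n k M} (hη : DForm.IsSmooth η)
    (hp : p ∈ (extChartAt (𝓡 n) x₀).source) :
    ContDiffAt ℝ ∞ (DForm.inChart η x₀) (extChartAt (𝓡 n) x₀ p) :=
  (hη x₀).contDiffAt ((isOpen_extChartAt_target x₀).mem_nhds
    ((extChartAt (𝓡 n) x₀).map_source hp))

variable [IsManifold (𝓡 n) ∞ M]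

lemma chartDeriv_inverse_fderiv (hp₀ : p ∈ (extChartAt (𝓡 n) x₀).source)
    (hp₁ : p ∈ (extChartAt (𝓡 n) x₁).source) (v : RSpace n) :
    (chartDeriv x₁ p).inverse (fderiv ℝ (chartChange x₀ x₁) (extChartAt (𝓡 n) x₀ p) v) =
      (chartDeriv x₀ p).inverse v := by
  have h := chartDeriv_eq_comp hp₀ hp₁ ((chartDeriv x₀ p).inverse v)
  rw [(isInvertible_chartDeriv hp₀).self_apply_inverse] at h
  rw [← h, (isInvertible_chartDeriv hp₁).inverse_apply_self]

lemma isInvertible_fderiv_chartChange (hp₀ : p ∈ (extChartAt (𝓡 n) x₀).source)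
    (hp₁ : p ∈ (extChartAt (𝓡 n) x₁).source) :
    (fderiv ℝ (chartChange x₀ x₁) (extChartAt (𝓡 n) x₀ p)).IsInvertible := by
  have h : fderiv ℝ (chartChange x₀ x₁) (extChartAt (𝓡 n) x₀ p) =
      (chartDeriv x₁ p).comp (chartDeriv x₀ p).inverse := by
    ext1 v
    rw [ContinuousLinearMap.comp_apply, ← chartDeriv_inverse_fderiv hp₀ hp₁,
      (isInvertible_chartDeriv hp₁).self_apply_inverse]
  rw [h]
  exact (isInvertible_chartDeriv hp₁).comp (isInvertible_chartDeriv hp₀).inverse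

lemma inChart_eq_pullback (η : DForm n k M) (hp₀ : p ∈ (extChartAt (𝓡 n) x₀).source)
    (hp₁ : p ∈ (extChartAt (𝓡 n) x₁).source) :
    DForm.inChart η x₀ (extChartAt (𝓡 n) x₀ p) =
      (DForm.inChart η x₁ (chartChange x₀ x₁ (extChartAt (𝓡 n) x₀ p))).compContinuousLinearMap
        (fderiv ℝ (chartChange x₀ x₁) (extChartAt (𝓡 n) x₀ p)) := by
  rw [chartChange_extChartAt hp₀, inChart_extChartAt η hp₀, inChart_extChartAt η hp₁]
  ext v
  simp only [ContinuousAlternatingMap.compContinuousLinearMap_apply]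
  congr 1
  ext1 i
  exact (chartDeriv_inverse_fderiv hp₀ hp₁ (v i)).symm

/-- The exterior derivative may be computed in any chart. -/
lemma inChart_d {η : DForm n k M} (hη : DForm.IsSmooth η)
    (hp : p ∈ (extChartAt (𝓡 n) x₀).source) :
    DForm.inChart (DForm.d η) x₀ (extChartAt (𝓡 n) x₀ p) =
      extDeriv (DForm.inChart η x₀) (extChartAt (𝓡 n) x₀ p) := by
  have hpp : p ∈ (extChartAt (𝓡 n) p).source := mem_extChartAt_source p
  have h1 : DForm.inChart η x₀ =ᶠ[𝓝 (extChartAt (𝓡 n) x₀ p)] fun y =>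
      (DForm.inChart η p (chartChange x₀ p y)).compContinuousLinearMap
        (fderiv ℝ (chartChange x₀ p) y) := by
    filter_upwards [eventually_mem_source hp hpp] with y hy
    obtain ⟨q, hq0, hq1, rfl⟩ := hy
    exact inChart_eq_pullback η hq0 hq1
  have h2 : DifferentiableAt ℝ (DForm.inChart η p) (chartChange x₀ p (extChartAt (𝓡 n) x₀ p)) := by
    rw [chartChange_extChartAt hp]
    exact (hη.contDiffAt hpp).differentiableAt (by simp)
  rw [h1.extDeriv_eq, extDeriv_pullback h2 (contDiffAt_chartChange hp hpp)
    (by simpa using two_le_infty),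
    chartChange_extChartAt hp, inChart_extChartAt _ hp, DForm.d]
  ext v
  simp only [ContinuousAlternatingMap.compContinuousLinearMap_apply]
  congr 1
  ext1 i
  have h := chartDeriv_eq_comp hp hpp ((chartDeriv x₀ p).inverse (v i))
  rw [(isInvertible_chartDeriv hp).self_apply_inverse] at h
  exact h

lemma contDiffOn_extDeriv {η : RSpace n → RSpace n [⋀^Fin k]→L[ℝ] ℝ} {s : Set (RSpace n)}
    (hs : IsOpen s) (hη : ContDiffOn ℝ ∞ η s) : ContDiffOn ℝ ∞ (extDeriv η) s := by
  have h : ContDiffOn ℝ ∞ (fderiv ℝ η) s := hη.fderiv_of_isOpen hs (by simp)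
  exact (ContinuousAlternatingMap.alternatizeUncurryFinCLM ℝ (RSpace n)
    ℝ).contDiff.comp_contDiffOn h

lemma DForm.IsSmooth.d {η : DForm n k M} (hη : DForm.IsSmooth η) : DForm.IsSmooth (DForm.d η) := by
  intro x₀
  refine (contDiffOn_extDeriv (isOpen_extChartAt_target x₀) (hη x₀)).congr fun y hy => ?_
  rw [← (extChartAt (𝓡 n) x₀).right_inv hy]
  exact inChart_d hη ((extChartAt (𝓡 n) x₀).map_target hy)

lemma DForm.IsSmooth.d_d {η : DForm n k M} (hη : DForm.IsSmooth η) (x : M) :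
    DForm.d (DForm.d η) x = 0 := by
  have hx : x ∈ (extChartAt (𝓡 n) x).source := mem_extChartAt_source x
  have h : DForm.inChart (DForm.d η) x =ᶠ[𝓝 (extChartAt (𝓡 n) x x)]
      extDeriv (DForm.inChart η x) :=
    eventually_nhds_extChartAt hx fun q hq => inChart_d hη hq
  rw [DForm.d, h.extDeriv_eq, extDeriv_extDeriv_apply (hη.contDiffAt hx)
    (by simpa using two_le_infty)]
  rfl

/-! ### The metric and the connection in a chart -/

lemma metric_inChart_symm (g : LorentzMetric n M) (hp : p ∈ (extChartAt (𝓡 n) x₀).source)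
    (u v : RSpace n) : g.inChart x₀ (extChartAt (𝓡 n) x₀ p) u v =
      g.inChart x₀ (extChartAt (𝓡 n) x₀ p) v u := by
  rw [metric_inChart_extChartAt g hp, metric_inChart_extChartAt g hp, g.symm]

lemma eventually_metric_symm (g : LorentzMetric n M) (hp : p ∈ (extChartAt (𝓡 n) x₀).source) :
    ∀ᶠ y in 𝓝 (extChartAt (𝓡 n) x₀ p), ∀ u v, g.inChart x₀ y u v = g.inChart x₀ y v u :=
  eventually_nhds_extChartAt hp fun _ hq => metric_inChart_symm g hq

lemma contDiffAt_metric (g : LorentzMetric n M) (hp : p ∈ (extChartAt (𝓡 n) x₀).source) :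
    ContDiffAt ℝ ∞ (g.inChart x₀) (extChartAt (𝓡 n) x₀ p) :=
  (contDiffOn_metric_inChart g x₀).contDiffAt ((isOpen_extChartAt_target x₀).mem_nhds
    ((extChartAt (𝓡 n) x₀).map_source hp))

lemma LorentzMetric.eq_zero_of_val_eq_zero (g : LorentzMetric n M) {u : TangentSpace (𝓡 n) p}
    (h : ∀ v, g.val p u v = 0) : u = 0 := by
  obtain ⟨b, hb⟩ := g.signature p
  have h1 : ∀ i, b.repr u i = 0 := by
    intro i
    have h2 := h (b i)
    rw [← b.sum_repr u] at h2
    simp only [map_sum, map_smul, sum_apply, smul_apply, hb, smul_eq_mul, mul_ite, mul_zero,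
      Finset.sum_ite_eq', Finset.mem_univ, if_true] at h2
    split_ifs at h2 <;> linarith
  rw [← b.sum_repr u]
  simp [h1]

lemma isInvertible_metric (g : LorentzMetric n M) (hp : p ∈ (extChartAt (𝓡 n) x₀).source) :
    (g.inChart x₀ (extChartAt (𝓡 n) x₀ p)).IsInvertible := by
  set A := g.inChart x₀ (extChartAt (𝓡 n) x₀ p) with hA
  have hinj : Function.Injective A := by
    rw [injective_iff_map_eq_zero]
    intro u hu
    have h1 : (chartDeriv x₀ p).inverse u = 0 := by
      refine g.eq_zero_of_val_eq_zero fun v => ?_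
      rw [← (isInvertible_chartDeriv hp).inverse_apply_self v, ← metric_inChart_extChartAt g hp,
        ← hA, hu]
      rfl
    rw [← (isInvertible_chartDeriv hp).self_apply_inverse u, h1, map_zero]
  have hdim : Module.finrank ℝ (RSpace n) = Module.finrank ℝ (RSpace n →L[ℝ] ℝ) := by
    rw [← (LinearMap.toContinuousLinearMap (𝕜 := ℝ) (E := RSpace n) (F' := ℝ)).finrank_eq]
    exact (Subspace.dual_finrank_eq).symm
  refine ⟨(LinearEquiv.ofInjectiveOfFinrankEq (A : RSpace n →ₗ[ℝ] _) hinj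
    hdim).toContinuousLinearEquiv, ?_⟩
  ext u v
  rfl

lemma IsSmoothVField.contDiffAt {Y : VField n M} (hY : IsSmoothVField Y)
    (hp : p ∈ (extChartAt (𝓡 n) x₀).source) :
    ContDiffAt ℝ ∞ (vecInChart Y x₀) (extChartAt (𝓡 n) x₀ p) :=
  (hY.contDiffOn_vecInChart x₀).contDiffAt ((isOpen_extChartAt_target x₀).mem_nhds
    ((extChartAt (𝓡 n) x₀).map_source hp))

/-- The Levi-Civita connection may be computed in any chart. -/
lemma chartDeriv_covDeriv (g : LorentzMetric n M) {Y : VField n M}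
    (hp : p ∈ (extChartAt (𝓡 n) x₀).source) (hY : IsSmoothVField Y) (v : TangentSpace (𝓡 n) p) :
    chartDeriv x₀ p (g.covDeriv Y p v) =
      coordCovDeriv (g.inChart x₀) (vecInChart Y x₀) (extChartAt (𝓡 n) x₀ p)
        (chartDeriv x₀ p v) := by
  have hpp : p ∈ (extChartAt (𝓡 n) p).source := mem_extChartAt_source p
  have h0 : g.covDeriv Y p v = (chartDeriv p p).inverse (coordCovDeriv (g.inChart p)
    (vecInChart Y p) (extChartAt (𝓡 n) p p) (chartDeriv p p v)) := rfl
  have hψ := chartChange_extChartAt (x₁ := x₀) hpp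
  have h := fderiv_coordCovDeriv (G := g.inChart p) (G' := g.inChart x₀)
    (ψ := chartChange p x₀) (y := extChartAt (𝓡 n) p p) (Y := vecInChart Y p)
    (Y' := vecInChart Y x₀)
    ((contDiffAt_chartChange hpp hp).of_le two_le_infty) (isInvertible_fderiv_chartChange hpp hp)
    (by rw [hψ]; exact (contDiffAt_metric g hp).differentiableAt (by simp))
    ((contDiffAt_metric g hpp).differentiableAt (by simp))
    (by
      filter_upwards [eventually_mem_source hpp hp] with y hy
      obtain ⟨q, hq0, hq1, rfl⟩ := hy
      intro u v
      rw [chartChange_extChartAt hq0, metric_inChart_extChartAt g hq0,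
        metric_inChart_extChartAt g hq1, chartDeriv_inverse_fderiv hq0 hq1,
        chartDeriv_inverse_fderiv hq0 hq1])
    (by rw [hψ]; exact metric_inChart_symm g hp)
    (isInvertible_metric g hpp)
    (by rw [hψ]; exact isInvertible_metric g hp)
    ((hY.contDiffAt hpp).differentiableAt (by simp))
    (by rw [hψ]; exact (hY.contDiffAt hp).differentiableAt (by simp))
    (by
      filter_upwards [eventually_mem_source hpp hp] with y hy
      obtain ⟨q, hq0, hq1, rfl⟩ := hy
      rw [chartChange_extChartAt hq0, vecInChart_extChartAt Y hq0, vecInChart_extChartAt Y hq1]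
      exact chartDeriv_eq_comp hq0 hq1 _)
    (chartDeriv p p v)
  rw [hψ, ← chartDeriv_eq_comp hpp hp] at h
  rw [h0, chartDeriv_eq_comp hpp hp, (isInvertible_chartDeriv hpp).self_apply_inverse]
  exact h.symm

/-! ### Derivatives, brackets and integral curves in a chart -/

lemma contDiffAt_comp_symm {f : M → ℝ} (hf : ContMDiff (𝓡 n) 𝓘(ℝ, ℝ) ∞ f)
    (hp : p ∈ (extChartAt (𝓡 n) x₀).source) :
    ContDiffAt ℝ ∞ (f ∘ (extChartAt (𝓡 n) x₀).symm) (extChartAt (𝓡 n) x₀ p) := by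
  have h : ContMDiffOn 𝓘(ℝ, RSpace n) 𝓘(ℝ, ℝ) ∞ (f ∘ (extChartAt (𝓡 n) x₀).symm)
      (extChartAt (𝓡 n) x₀).target := hf.comp_contMDiffOn (contMDiffOn_symm x₀)
  exact (contMDiffOn_iff_contDiffOn.1 h).contDiffAt ((isOpen_extChartAt_target x₀).mem_nhds
    ((extChartAt (𝓡 n) x₀).map_source hp))

lemma dirDeriv_eq {f : M → ℝ} (hp : p ∈ (extChartAt (𝓡 n) x₀).source)
    (hf : DifferentiableAt ℝ (f ∘ (extChartAt (𝓡 n) x₀).symm) (extChartAt (𝓡 n) x₀ p))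
    (Y : VField n M) :
    dirDeriv Y f p = fderiv ℝ (f ∘ (extChartAt (𝓡 n) x₀).symm) (extChartAt (𝓡 n) x₀ p)
      (chartDeriv x₀ p (Y p)) := by
  have : IsManifold (𝓡 n) 1 M := IsManifold.of_le (n := ∞) (by simp)
  have h1 : MDifferentiableAt (𝓡 n) 𝓘(ℝ, RSpace n) (extChartAt (𝓡 n) x₀) p :=
    mdifferentiableAt_extChartAt (by simpa using hp)
  have h2 : MDifferentiableAt 𝓘(ℝ, RSpace n) 𝓘(ℝ, ℝ) (f ∘ (extChartAt (𝓡 n) x₀).symm)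
      (extChartAt (𝓡 n) x₀ p) :=
    hf.mdifferentiableAt
  have h3 := mfderiv_comp p h2 h1
  have h4 : f =ᶠ[𝓝 p] (f ∘ (extChartAt (𝓡 n) x₀).symm) ∘ extChartAt (𝓡 n) x₀ := by
    filter_upwards [(isOpen_extChartAt_source x₀).mem_nhds hp] with q hq
    rw [Function.comp_apply, Function.comp_apply, (extChartAt (𝓡 n) x₀).left_inv hq]
  have h5 : dirDeriv Y f p = mfderiv (𝓡 n) 𝓘(ℝ, ℝ) f p (Y p) := rfl
  have h6 : mfderiv (𝓡 n) 𝓘(ℝ, ℝ) f p = mfderiv (𝓡 n) 𝓘(ℝ, ℝ)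
      ((f ∘ (extChartAt (𝓡 n) x₀).symm) ∘ extChartAt (𝓡 n) x₀) p := h4.mfderiv_eq
  rw [h5, h6, h3, mfderiv_eq_fderiv]
  rfl

lemma chartDeriv_mlieBracket (X Y : VField n M) (x : M) :
    chartDeriv x x (VectorField.mlieBracket (𝓡 n) X Y x) =
      fderiv ℝ (vecInChart Y x) (extChartAt (𝓡 n) x x) (chartDeriv x x (X x)) -
      fderiv ℝ (vecInChart X x) (extChartAt (𝓡 n) x x) (chartDeriv x x (Y x)) := by
  have hx : x ∈ (extChartAt (𝓡 n) x).source := mem_extChartAt_source x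
  let A (V : VField n M) : RSpace n → RSpace n := VectorField.mpullbackWithin 𝓘(ℝ, RSpace n) (𝓡 n)
      (extChartAt (𝓡 n) x).symm V (range (𝓡 n))
  have h : ∀ V : VField n M, A V =ᶠ[𝓝 (extChartAt (𝓡 n) x x)] vecInChart V x := by
    intro V
    filter_upwards [extChartAt_target_mem_nhds (I := 𝓡 n) x] with y hy
    have h0 : A V y = (mfderivWithin 𝓘(ℝ, RSpace n) (𝓡 n) (extChartAt (𝓡 n) x).symm
      (range (𝓡 n)) y).inverse (V ((extChartAt (𝓡 n) x).symm y)) := rfl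
    rw [h0, ModelWithCorners.range_eq_univ, mfderivWithin_univ]
    change (chartInvDeriv x y).inverse _ = _
    rw [chartInvDeriv_eq hy, (isInvertible_chartDeriv
      ((extChartAt (𝓡 n) x).map_target hy)).inverse_inverse]
    rfl
  have h2 : VectorField.mlieBracket (𝓡 n) X Y x = (chartDeriv x x).inverse
      (VectorField.lieBracket ℝ (vecInChart X x) (vecInChart Y x) (extChartAt (𝓡 n) x x)) := by
    have h3 : VectorField.mlieBracketWithin (𝓡 n) X Y univ x = (chartDeriv x x).inverse
        (VectorField.lieBracketWithin ℝ (A X) (A Y)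
          ((extChartAt (𝓡 n) x).symm ⁻¹' univ ∩ range (𝓡 n)) (extChartAt (𝓡 n) x x)) :=
      VectorField.mlieBracketWithin_apply
    rw [VectorField.mlieBracketWithin_univ, preimage_univ, univ_inter,
      ModelWithCorners.range_eq_univ, VectorField.lieBracketWithin_univ,
      (h X).lieBracket_vectorField_eq (h Y)] at h3
    exact h3
  rw [h2, (isInvertible_chartDeriv hx).self_apply_inverse, VectorField.lieBracket,
    vecInChart_extChartAt X hx, vecInChart_extChartAt Y hx]

lemma IsMIntegralCurve.hasDerivAt_extChartAt {γ : ℝ → M} {K : VField n M}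
    (hγ : IsMIntegralCurve γ K) {t : ℝ} (ht : γ t ∈ (extChartAt (𝓡 n) x₀).source) :
    HasDerivAt (extChartAt (𝓡 n) x₀ ∘ γ) (vecInChart K x₀ (extChartAt (𝓡 n) x₀ (γ t))) t := by
  have : IsManifold (𝓡 n) 1 M := IsManifold.of_le (n := ∞) (by simp)
  have h1 : HasMFDerivAt (𝓡 n) 𝓘(ℝ, RSpace n) (extChartAt (𝓡 n) x₀) (γ t)
      (chartDeriv x₀ (γ t)) :=
    (mdifferentiableAt_extChartAt (by simpa using ht)).hasMFDerivAt
  have h2 := (HasMFDerivAt.comp t h1 (hγ t))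
  have h3 : HasMFDerivAt 𝓘(ℝ, ℝ) 𝓘(ℝ, RSpace n) (extChartAt (𝓡 n) x₀ ∘ γ) t
      (ContinuousLinearMap.toSpanSingleton ℝ (chartDeriv x₀ (γ t) (K (γ t)) : RSpace n)) := by
    refine h2.congr_mfderiv ?_
    ext1
    change chartDeriv x₀ (γ t) ((1 : ℝ) • K (γ t)) = (1 : ℝ) • chartDeriv x₀ (γ t) (K (γ t))
    exact map_smul _ _ _
  rw [vecInChart_extChartAt K ht, hasDerivAt_iff_hasFDerivAt]
  exact hasMFDerivAt_iff_hasFDerivAt.1 h3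

end Naturality

section Flat

variable {n k : ℕ} {M : Type*} [TopologicalSpace M] [ChartedSpace (RSpace n) M]
  [IsManifold (𝓡 n) ∞ M] {x₀ x₁ p : M}

/-! ### The 1-form of a vector field, in a chart -/

/-- The coordinate expression of `g(Y, ·)`, as a covector. -/
def flatInChart (g : LorentzMetric n M) (Y : VField n M) (x₀ : M) (y : RSpace n) :
    RSpace n →L[ℝ] ℝ :=
  g.inChart x₀ y (vecInChart Y x₀ y)

lemma flatInChart_chartDeriv (g : LorentzMetric n M) (Y : VField n M)
    (hp : p ∈ (extChartAt (𝓡 n) x₀).source) (v : TangentSpace (𝓡 n) p) :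
    flatInChart g Y x₀ (extChartAt (𝓡 n) x₀ p) (chartDeriv x₀ p v) = g.val p (Y p) v := by
  rw [flatInChart, vecInChart_extChartAt Y hp, metric_inChart_chartDeriv g hp]

/-- The identification of covectors with alternating maps in one variable. -/
def covectorForm (n : ℕ) : (RSpace n →L[ℝ] ℝ) →L[ℝ] RSpace n [⋀^Fin 1]→L[ℝ] ℝ :=
  (ContinuousAlternatingMap.ofSubsingletonLIE (𝕜 := ℝ) (E := RSpace n) (F := ℝ)
    (0 : Fin 1)).toContinuousLinearEquiv

lemma covectorForm_apply (a : RSpace n →L[ℝ] ℝ) (v : Fin 1 → RSpace n) :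
    covectorForm n a v = a (v 0) := rfl

lemma inChart_flat (g : LorentzMetric n M) (Y : VField n M)
    (hp : p ∈ (extChartAt (𝓡 n) x₀).source) :
    DForm.inChart (g.flat Y) x₀ (extChartAt (𝓡 n) x₀ p) =
      covectorForm n (flatInChart g Y x₀ (extChartAt (𝓡 n) x₀ p)) := by
  rw [inChart_extChartAt _ hp]
  ext v
  rw [covectorForm_apply, ← (isInvertible_chartDeriv hp).self_apply_inverse (v 0),
    flatInChart_chartDeriv g Y hp]
  rfl

lemma contDiffAt_flatInChart (g : LorentzMetric n M) {Y : VField n M} (hY : IsSmoothVField Y)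
    (hp : p ∈ (extChartAt (𝓡 n) x₀).source) :
    ContDiffAt ℝ ∞ (flatInChart g Y x₀) (extChartAt (𝓡 n) x₀ p) :=
  (contDiffAt_metric g hp).clm_apply (hY.contDiffAt hp)

lemma isSmooth_flat (g : LorentzMetric n M) {Y : VField n M} (hY : IsSmoothVField Y) :
    DForm.IsSmooth (g.flat Y) := by
  intro x₀ y hy
  have hp := (extChartAt (𝓡 n) x₀).map_target hy
  have h := contDiffAt_flatInChart g hY hp
  rw [(extChartAt (𝓡 n) x₀).right_inv hy] at h
  refine (((covectorForm n).contDiff.contDiffAt.comp y h).contDiffWithinAt).congr_of_mem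
    (fun z hz => ?_) hy
  rw [← (extChartAt (𝓡 n) x₀).right_inv hz]
  exact inChart_flat g Y ((extChartAt (𝓡 n) x₀).map_target hz)

/-- The 2-form `d(g(Y, ·))` in a chart. -/
lemma d_flat_apply (g : LorentzMetric n M) {Y : VField n M} (hY : IsSmoothVField Y)
    (hp : p ∈ (extChartAt (𝓡 n) x₀).source) (u v : TangentSpace (𝓡 n) p) :
    DForm.d (g.flat Y) p ![u, v] =
      curl (flatInChart g Y x₀) (extChartAt (𝓡 n) x₀ p) (chartDeriv x₀ p u)
        (chartDeriv x₀ p v) := by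
  have h1 := inChart_d (isSmooth_flat g hY) hp
  rw [inChart_extChartAt _ hp] at h1
  have h2 := congr_arg (fun A => A ![chartDeriv x₀ p u, chartDeriv x₀ p v]) h1
  simp only [ContinuousAlternatingMap.compContinuousLinearMap_apply] at h2
  have h3 : (⇑(chartDeriv x₀ p).inverse ∘ ![chartDeriv x₀ p u, chartDeriv x₀ p v]) = ![u, v] := by
    funext i
    fin_cases i
    · exact (isInvertible_chartDeriv hp).inverse_apply_self u
    · exact (isInvertible_chartDeriv hp).inverse_apply_self v
  rw [h3] at h2
  rw [h2]
  have ha : HasFDerivAt (flatInChart g Y x₀) _ (extChartAt (𝓡 n) x₀ p) :=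
    ((contDiffAt_flatInChart g hY hp).differentiableAt (by simp)).hasFDerivAt
  have h4 : DForm.inChart (g.flat Y) x₀ =ᶠ[𝓝 (extChartAt (𝓡 n) x₀ p)]
      covectorForm n ∘ flatInChart g Y x₀ :=
    eventually_nhds_extChartAt hp fun q hq => inChart_flat g Y hq
  have h5 : HasFDerivAt (covectorForm n ∘ flatInChart g Y x₀)
      ((covectorForm n).comp (fderiv ℝ (flatInChart g Y x₀) (extChartAt (𝓡 n) x₀ p)))
      (extChartAt (𝓡 n) x₀ p) := (covectorForm n).hasFDerivAt.comp _ ha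
  have h6 : ∀ u w : RSpace n, fderiv ℝ (fun y => flatInChart g Y x₀ y w) (extChartAt (𝓡 n) x₀ p) u =
      fderiv ℝ (flatInChart g Y x₀) (extChartAt (𝓡 n) x₀ p) u w := by
    intro u w
    rw [(ha.clm_apply (hasFDerivAt_const w _)).fderiv]
    simp
  rw [h4.extDeriv_eq, extDeriv_apply h5.differentiableAt, Fin.sum_univ_two, curl_apply, ← h6, ← h6]
  simp [covectorForm_apply, Fin.removeNth, sub_eq_add_neg]

end Flat

/-! ### Rescaled vector fields -/

lemma curl_smul {E : Type*} [NormedAddCommGroup E] [NormedSpace ℝ E] {c : E → ℝ}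
    {a : E → E →L[ℝ] ℝ} {y : E} (hc : DifferentiableAt ℝ c y) (ha : DifferentiableAt ℝ a y)
    (u v : E) :
    curl (fun y' => c y' • a y') y u v =
      fderiv ℝ c y u * a y v - fderiv ℝ c y v * a y u + c y * curl a y u v := by
  rw [curl_apply, curl_apply, (hc.hasFDerivAt.fun_smul ha.hasFDerivAt).fderiv]
  simp
  ring

section Rescale

variable {n : ℕ} {M : Type*} [TopologicalSpace M] [ChartedSpace (RSpace n) M]
  {x₀ p : M}

lemma vecInChart_smul (c : M → ℝ) (Y : VField n M) (y : RSpace n) :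
    vecInChart (fun x => c x • Y x) x₀ y =
      (c ∘ (extChartAt (𝓡 n) x₀).symm) y • vecInChart Y x₀ y :=
  map_smul (chartDeriv x₀ ((extChartAt (𝓡 n) x₀).symm y)) _ _

variable [IsManifold (𝓡 n) ∞ M]

lemma IsSmoothVField.smul {c : M → ℝ} {Y : VField n M} (hc : ContMDiff (𝓡 n) 𝓘(ℝ, ℝ) ∞ c)
    (hY : IsSmoothVField Y) : IsSmoothVField (fun x => c x • Y x) :=
  ContMDiff.smul_section hc hY

lemma contMDiff_dirDeriv {f : M → ℝ} {Y : VField n M} (hf : ContMDiff (𝓡 n) 𝓘(ℝ, ℝ) ∞ f)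
    (hY : IsSmoothVField Y) : ContMDiff (𝓡 n) 𝓘(ℝ, ℝ) ∞ (dirDeriv Y f) := by
  intro p
  have hp : p ∈ (extChartAt (𝓡 n) p).source := mem_extChartAt_source p
  have h1 : ContDiffAt ℝ ∞ (fun y => fderiv ℝ (f ∘ (extChartAt (𝓡 n) p).symm) y
      (vecInChart Y p y)) (extChartAt (𝓡 n) p p) :=
    ((contDiffAt_comp_symm hf hp).fderiv_right (m := ∞) (by simp)).clm_apply (hY.contDiffAt hp)
  have h2 : ContMDiffAt (𝓡 n) 𝓘(ℝ, RSpace n) ∞ (extChartAt (𝓡 n) p) p := contMDiffAt_extChartAt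
  refine (h1.contMDiffAt.comp p h2).congr_of_eventuallyEq ?_
  filter_upwards [(isOpen_extChartAt_source p).mem_nhds hp] with q hq
  rw [dirDeriv_eq hq ((contDiffAt_comp_symm hf hq).differentiableAt (by simp)),
    Function.comp_apply, vecInChart_extChartAt Y hq]

lemma flatInChart_smul (g : LorentzMetric n M) (c : M → ℝ) (Y : VField n M) :
    flatInChart g (fun x => c x • Y x) x₀ = fun y =>
      (c ∘ (extChartAt (𝓡 n) x₀).symm) y • flatInChart g Y x₀ y := by
  funext y
  rw [flatInChart, vecInChart_smul, map_smul]
  rfl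

end Rescale

/-! ### Geodesic null fields -/

section NullGeodesic

variable {n : ℕ} {M : Type*} [TopologicalSpace M] [ChartedSpace (RSpace n) M]
  [IsManifold (𝓡 n) ∞ M] {x₀ p : M} {g : LorentzMetric n M} {K : VField n M}

lemma flatInChart_self (hnull : g.IsNull K) (hp : p ∈ (extChartAt (𝓡 n) x₀).source) :
    flatInChart g K x₀ (extChartAt (𝓡 n) x₀ p) (vecInChart K x₀ (extChartAt (𝓡 n) x₀ p)) = 0 := by
  rw [vecInChart_extChartAt K hp, flatInChart_chartDeriv g K hp, (hnull p).2]

lemma eventually_flatInChart_self (hnull : g.IsNull K)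
    (hp : p ∈ (extChartAt (𝓡 n) x₀).source) : ∀ᶠ y in 𝓝 (extChartAt (𝓡 n) x₀ p),
      flatInChart g K x₀ y (vecInChart K x₀ y) = 0 :=
  eventually_nhds_extChartAt hp fun _ hq => flatInChart_self hnull hq

lemma curl_flatInChart_self (hK : IsSmoothVField K) (hnull : g.IsNull K)
    (hgeod : ∀ x, g.covDeriv K x (K x) = 0) (hp : p ∈ (extChartAt (𝓡 n) x₀).source) :
    curl (flatInChart g K x₀) (extChartAt (𝓡 n) x₀ p)
      (vecInChart K x₀ (extChartAt (𝓡 n) x₀ p)) = 0 := by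
  refine curl_lower_self ((contDiffAt_metric g hp).differentiableAt (by simp))
    (eventually_metric_symm g hp) (isInvertible_metric g hp)
    ((hK.contDiffAt hp).differentiableAt (by simp)) (eventually_flatInChart_self hnull hp) ?_
  rw [vecInChart_extChartAt K hp, ← chartDeriv_covDeriv g hp hK, hgeod, map_zero]

lemma eventually_curl_flatInChart_self (hK : IsSmoothVField K) (hnull : g.IsNull K)
    (hgeod : ∀ x, g.covDeriv K x (K x) = 0) (hp : p ∈ (extChartAt (𝓡 n) x₀).source) :
    ∀ᶠ y in 𝓝 (extChartAt (𝓡 n) x₀ p), curl (flatInChart g K x₀) y (vecInChart K x₀ y) = 0 :=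
  eventually_nhds_extChartAt hp fun _ hq => curl_flatInChart_self hK hnull hgeod hq

lemma flatInChart_ne_zero (hnull : g.IsNull K) (hp : p ∈ (extChartAt (𝓡 n) x₀).source) :
    flatInChart g K x₀ (extChartAt (𝓡 n) x₀ p) ≠ 0 := by
  intro h
  refine (hnull p).1 (g.eq_zero_of_val_eq_zero fun v => ?_)
  rw [← flatInChart_chartDeriv g K hp, h]
  rfl

/-- The field `K` is twist-free at `q` if `d(g(K, ·))` vanishes on `K^⊥`, the kernel of
`g(K, ·)`. -/
def IsTwistFreeAt (g : LorentzMetric n M) (K : VField n M) (q : M) : Prop :=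
  ∀ u v : TangentSpace (𝓡 n) q, g.val q (K q) u = 0 → g.val q (K q) v = 0 →
    DForm.d (g.flat K) q ![u, v] = 0

/-- Being twist-free means `a ∧ da = 0` for `a = g(K, ·)`. -/
lemma isTwistFreeAt_iff (hK : IsSmoothVField K) (hnull : g.IsNull K)
    (hp : p ∈ (extChartAt (𝓡 n) x₀).source) :
    IsTwistFreeAt g K p ↔ ∀ u v w, wedgeOneTwo (flatInChart g K x₀ (extChartAt (𝓡 n) x₀ p))
      (curl (flatInChart g K x₀) (extChartAt (𝓡 n) x₀ p)) u v w = 0 := by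
  rw [wedgeOneTwo_eq_zero_iff (flatInChart_ne_zero hnull hp)
    fun u v => by rw [curl_apply, curl_apply, neg_sub]]
  have hi := isInvertible_chartDeriv hp
  constructor
  · intro h u v hu hv
    rw [← hi.self_apply_inverse u] at hu ⊢
    rw [← hi.self_apply_inverse v] at hv ⊢
    rw [flatInChart_chartDeriv g K hp] at hu hv
    rw [← d_flat_apply g hK hp]
    exact h _ _ hu hv
  · intro h u v hu hv
    rw [d_flat_apply g hK hp]
    exact h _ _ (by rwa [flatInChart_chartDeriv g K hp]) (by rwa [flatInChart_chartDeriv g K hp])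

/-- The twist of a geodesic null field either vanishes along a whole integral curve or nowhere
on it. -/
lemma IsTwistFreeAt.of_integralCurve (hK : IsSmoothVField K) (hnull : g.IsNull K)
    (hgeod : ∀ x, g.covDeriv K x (K x) = 0) {γ : ℝ → M} (hγ : IsMIntegralCurve γ K) {s : ℝ}
    (hs : IsTwistFreeAt g K (γ s)) (t : ℝ) : IsTwistFreeAt g K (γ t) := by
  have key : ∀ t₀, ∃ ε > 0, ∀ s ∈ Ioo (t₀ - ε) (t₀ + ε), ∀ t ∈ Ioo (t₀ - ε) (t₀ + ε),
      IsTwistFreeAt g K (γ s) → IsTwistFreeAt g K (γ t) := by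
    intro t₀
    have hp : γ t₀ ∈ (extChartAt (𝓡 n) (γ t₀)).source := mem_extChartAt_source _
    have hsrc : ∀ᶠ t in 𝓝 t₀, γ t ∈ (extChartAt (𝓡 n) (γ t₀)).source :=
      hγ.continuous.continuousAt.eventually ((isOpen_extChartAt_source (γ t₀)).mem_nhds hp)
    obtain ⟨ε, hε, h⟩ := wedge_curl_propagates (a := flatInChart g K (γ t₀))
      (k := vecInChart K (γ t₀)) (γ := extChartAt (𝓡 n) (γ t₀) ∘ γ) (t₀ := t₀)
      (eventually_nhds_extChartAt hp fun q hq =>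
        (contDiffAt_flatInChart g hK hq).of_le two_le_infty)
      (eventually_nhds_extChartAt hp fun q hq => (hK.contDiffAt hq).differentiableAt (by simp))
      (((hK.contDiffAt hp).fderiv_right (m := 0) (by simp)).continuousAt)
      (eventually_flatInChart_self hnull hp)
      (eventually_curl_flatInChart_self hK hnull hgeod hp)
      (hsrc.mono fun t ht => hγ.hasDerivAt_extChartAt ht)
    obtain ⟨δ, hδ, hball⟩ := Metric.eventually_nhds_iff_ball.1 hsrc
    have hmem : ∀ r ∈ Ioo (t₀ - min ε δ) (t₀ + min ε δ), r ∈ Ioo (t₀ - ε) (t₀ + ε) ∧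
        γ r ∈ (extChartAt (𝓡 n) (γ t₀)).source := by
      intro r hr
      have h1 := min_le_left ε δ
      have h2 := min_le_right ε δ
      refine ⟨⟨by linarith [hr.1], by linarith [hr.2]⟩, hball r ?_⟩
      rw [Real.ball_eq_Ioo]
      exact ⟨by linarith [hr.1], by linarith [hr.2]⟩
    refine ⟨min ε δ, lt_min hε hδ, fun s hs t ht hN => ?_⟩
    rw [isTwistFreeAt_iff hK hnull (hmem t ht).2]
    exact h s (hmem s hs).1 t (hmem t ht).1 ((isTwistFreeAt_iff hK hnull (hmem s hs).2).1 hN)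
  have hself : ∀ t₀ ε : ℝ, 0 < ε → t₀ ∈ Ioo (t₀ - ε) (t₀ + ε) := fun t₀ ε h =>
    ⟨by linarith, by linarith⟩
  have hclopen : IsClopen {t | IsTwistFreeAt g K (γ t)} := by
    constructor
    · rw [← isOpen_compl_iff, isOpen_iff_mem_nhds]
      intro t₀ h0
      obtain ⟨ε, hε, h⟩ := key t₀
      filter_upwards [Ioo_mem_nhds (hself t₀ ε hε).1 (hself t₀ ε hε).2] with s hs hN
      exact h0 (h s hs t₀ (hself t₀ ε hε) hN)
    · rw [isOpen_iff_mem_nhds]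
      intro t₀ h0
      obtain ⟨ε, hε, h⟩ := key t₀
      filter_upwards [Ioo_mem_nhds (hself t₀ ε hε).1 (hself t₀ ε hε).2] with s hs
      exact h t₀ (hself t₀ ε hε) s hs h0
  exact eq_univ_iff_forall.1 (hclopen.eq_univ ⟨s, hs⟩) t

end NullGeodesic

/-! ### Raychaudhuri's equation along the integral curves -/

section Focusing

variable {n : ℕ} {M : Type*} [TopologicalSpace M] [ChartedSpace (RSpace n) M]
  [IsManifold (𝓡 n) ∞ M] {x₀ p : M} {g : LorentzMetric n M} {K : VField n M}

/-- The covariant derivative at `x` depends only on the germ at `x` of the coordinate expression in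
the chart centred at `x`; no smoothness is needed. -/
lemma chartDeriv_covDeriv_self (g : LorentzMetric n M) {W : VField n M} {x : M}
    {W' : RSpace n → RSpace n} (hW : vecInChart W x =ᶠ[𝓝 (extChartAt (𝓡 n) x x)] W')
    (v : TangentSpace (𝓡 n) x) :
    chartDeriv x x (g.covDeriv W x v) =
      coordCovDeriv (g.inChart x) W' (extChartAt (𝓡 n) x x) (chartDeriv x x v) := by
  have h0 : g.covDeriv W x v = (chartDeriv x x).inverse (coordCovDeriv (g.inChart x)
    (vecInChart W x) (extChartAt (𝓡 n) x x) (chartDeriv x x v)) := rfl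
  rw [h0, (isInvertible_chartDeriv (mem_extChartAt_source x)).self_apply_inverse, coordCovDeriv,
    coordCovDeriv, hW.fderiv_eq, hW.self_of_nhds]

lemma vecInChart_coordField (x : M) (i : Fin n) :
    vecInChart (LorentzMetric.coordField x i) x =ᶠ[𝓝 (extChartAt (𝓡 n) x x)]
      fun _ => EuclideanSpace.single i 1 :=
  eventually_nhds_extChartAt (mem_extChartAt_source x) fun q hq => by
    rw [vecInChart_extChartAt _ hq]
    exact (isInvertible_chartDeriv hq).self_apply_inverse _

/-- The Ricci curvature `Ric(K, K)` of a geodesic field, in the chart centred at `x`. -/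
lemma ricci_eq (hK : IsSmoothVField K) (hgeod : ∀ x, g.covDeriv K x (K x) = 0) (x : M) :
    g.ricci K K x = ∑ i, (- coordCovDeriv (g.inChart x) (fun y' => coordCovDeriv (g.inChart x)
        (vecInChart K x) y' (EuclideanSpace.single i 1)) (extChartAt (𝓡 n) x x)
          (vecInChart K x (extChartAt (𝓡 n) x x))
      - coordCovDeriv (g.inChart x) (vecInChart K x) (extChartAt (𝓡 n) x x)
        (fderiv ℝ (vecInChart K x) (extChartAt (𝓡 n) x x) (EuclideanSpace.single i 1))) i := by
  have hx : x ∈ (extChartAt (𝓡 n) x).source := mem_extChartAt_source x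
  refine Finset.sum_congr rfl fun i _ => ?_
  have he : chartDeriv x x (LorentzMetric.coordField x i x) = EuclideanSpace.single i 1 :=
    (isInvertible_chartDeriv hx).self_apply_inverse _
  have h1 : chartDeriv x x (g.covDeriv (fun y => g.covDeriv K y (K y)) x
      (LorentzMetric.coordField x i x)) = 0 := by
    rw [chartDeriv_covDeriv_self g (W' := fun _ => 0)
      (Filter.Eventually.of_forall fun y => by simp only [vecInChart, hgeod, map_zero])]
    simp [coordCovDeriv, coordChristoffel]
  have h2 := chartDeriv_covDeriv_self g
    (W := fun y => g.covDeriv K y (LorentzMetric.coordField x i y)) (x := x)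
    (W' := fun y' => coordCovDeriv (g.inChart x) (vecInChart K x) y' (EuclideanSpace.single i 1))
    (eventually_nhds_extChartAt hx fun q hq => by
      rw [vecInChart_extChartAt _ hq, chartDeriv_covDeriv g hq hK]
      congr 1
      exact (isInvertible_chartDeriv hq).self_apply_inverse _) (K x)
  have h3 : chartDeriv x x (VectorField.mlieBracket (𝓡 n) (LorentzMetric.coordField x i) K x) =
      fderiv ℝ (vecInChart K x) (extChartAt (𝓡 n) x x) (EuclideanSpace.single i 1) := by
    rw [chartDeriv_mlieBracket, he, (vecInChart_coordField x i).fderiv_eq]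
    simp
  refine congrArg (fun z : RSpace n => z i) ?_
  rw [LorentzMetric.curvature, map_sub, map_sub, h1, h2, chartDeriv_covDeriv g hx hK, h3,
    vecInChart_extChartAt K hx, zero_sub]

/-- In a chart, `∇K` is conjugated by the derivative of the chart. -/
lemma exists_conj_covDeriv (hK : IsSmoothVField K) (hp : p ∈ (extChartAt (𝓡 n) x₀).source) :
    ∃ e : TangentSpace (𝓡 n) p ≃ₗ[ℝ] RSpace n, (∀ v, e v = chartDeriv x₀ p v) ∧
      (coordCovDeriv (g.inChart x₀) (vecInChart K x₀) (extChartAt (𝓡 n) x₀ p) :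
        RSpace n →ₗ[ℝ] RSpace n) = e.conj (g.covDeriv K p : _ →ₗ[ℝ] TangentSpace (𝓡 n) p) := by
  obtain ⟨e, he⟩ := isInvertible_chartDeriv (n := n) hp
  have he' : ∀ v, e v = chartDeriv x₀ p v := fun v => by rw [← he]; rfl
  refine ⟨e.toLinearEquiv, he', ?_⟩
  ext1 v
  obtain ⟨w, rfl⟩ := e.surjective v
  rw [LinearEquiv.conj_apply_apply]
  change coordCovDeriv (g.inChart x₀) (vecInChart K x₀) (extChartAt (𝓡 n) x₀ p) (e w) =
    e (g.covDeriv K p (e.symm (e w)))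
  rw [e.symm_apply_apply, he', he', chartDeriv_covDeriv g hp hK]

/-- The divergence of a vector field, the trace of its covariant derivative. -/
def divergence (g : LorentzMetric n M) (K : VField n M) (q : M) : ℝ :=
  LinearMap.trace ℝ (TangentSpace (𝓡 n) q) (g.covDeriv K q)

lemma divergence_eq (hK : IsSmoothVField K) (hp : p ∈ (extChartAt (𝓡 n) x₀).source) :
    divergence g K p =
      coordDiv (g.inChart x₀) (vecInChart K x₀) (extChartAt (𝓡 n) x₀ p) := by
  obtain ⟨e, -, he⟩ := exists_conj_covDeriv (g := g) hK hp
  rw [coordDiv, he, LinearMap.trace_conj', divergence]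

/-- Raychaudhuri's equation `θ' = -Ric(K, K) - tr (∇K)²` for the divergence `θ` of a geodesic
field `K`. -/
lemma hasDerivAt_divergence (hK : IsSmoothVField K) (hgeod : ∀ x, g.covDeriv K x (K x) = 0)
    {γ : ℝ → M} (hγ : IsMIntegralCurve γ K) (t : ℝ) :
    HasDerivAt (fun t => divergence g K (γ t)) (- g.ricci K K (γ t) -
      LinearMap.trace ℝ (RSpace n)
        ((coordCovDeriv (g.inChart (γ t)) (vecInChart K (γ t)) (extChartAt (𝓡 n) (γ t) (γ t)) :
          RSpace n →ₗ[ℝ] RSpace n) ∘ₗ coordCovDeriv (g.inChart (γ t)) (vecInChart K (γ t))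
            (extChartAt (𝓡 n) (γ t) (γ t)))) t := by
  have hp : γ t ∈ (extChartAt (𝓡 n) (γ t)).source := mem_extChartAt_source _
  have hB := differentiableAt_coordCovDeriv ((contDiffAt_metric g hp).of_le two_le_infty)
    (isInvertible_metric g hp) ((hK.contDiffAt hp).of_le two_le_infty)
  have hR := coord_raychaudhuri (eventually_metric_symm g hp)
    ((contDiffAt_metric g hp).differentiableAt (by simp)) (isInvertible_metric g hp) hB
  rw [← ricci_eq hK hgeod] at hR
  have h1 : HasDerivAt (coordDiv (g.inChart (γ t)) (vecInChart K (γ t)) ∘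
      (extChartAt (𝓡 n) (γ t) ∘ γ)) (fderiv ℝ (coordDiv (g.inChart (γ t)) (vecInChart K (γ t)))
        (extChartAt (𝓡 n) (γ t) (γ t)) (vecInChart K (γ t) (extChartAt (𝓡 n) (γ t) (γ t)))) t :=
    HasFDerivAt.comp_hasDerivAt t (differentiableAt_coordDiv hB).hasFDerivAt
      (hγ.hasDerivAt_extChartAt hp)
  have h2 : (fun s => divergence g K (γ s)) =ᶠ[𝓝 t]
      coordDiv (g.inChart (γ t)) (vecInChart K (γ t)) ∘ (extChartAt (𝓡 n) (γ t) ∘ γ) := by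
    filter_upwards [hγ.continuous.continuousAt.eventually
      ((isOpen_extChartAt_source (γ t)).mem_nhds hp)] with s hs
    exact divergence_eq hK hs
  have h3 := h1.congr_of_eventuallyEq h2
  rw [hR, neg_sub, sub_neg_eq_add, add_sub_cancel_left]
  exact h3

end Focusing

section Twisting

variable {M : Type*} [TopologicalSpace M] [ChartedSpace (RSpace 4) M]
  [IsManifold (𝓡 4) ∞ M] {x₀ p : M} {g : LorentzMetric 4 M} {K : VField 4 M}

lemma exists_isLorentzBasis (g : LorentzMetric 4 M) (hp : p ∈ (extChartAt (𝓡 4) x₀).source) :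
    ∃ b, IsLorentzBasis (g.inChart x₀ (extChartAt (𝓡 4) x₀ p)) b := by
  obtain ⟨b, hb⟩ := g.signature p
  obtain ⟨e, he⟩ := isInvertible_chartDeriv (n := 4) hp
  have he' : ∀ v, e v = chartDeriv x₀ p v := fun v => by rw [← he]; rfl
  refine ⟨b.map e.toLinearEquiv, fun i j => ?_⟩
  have h : ∀ i, b.map e.toLinearEquiv i = chartDeriv x₀ p (b i) := fun i => by
    rw [Module.Basis.map_apply]; exact he' _
  rw [h, h, metric_inChart_chartDeriv g hp, hb]

lemma vecInChart_ne_zero (hnull : g.IsNull K) (hp : p ∈ (extChartAt (𝓡 4) x₀).source) :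
    vecInChart K x₀ (extChartAt (𝓡 4) x₀ p) ≠ 0 := by
  rw [vecInChart_extChartAt K hp]
  intro h
  refine (hnull p).1 ?_
  rw [← (isInvertible_chartDeriv hp).inverse_apply_self (K p), h, map_zero]

/-- At a twist-free point, `∇K` induces a symmetric endomorphism of `K^⊥/K`. -/
lemma IsTwistFreeAt.sq_divergence_le (hK : IsSmoothVField K) (hnull : g.IsNull K)
    (hgeod : ∀ x, g.covDeriv K x (K x) = 0) (hp : p ∈ (extChartAt (𝓡 4) x₀).source)
    (h : IsTwistFreeAt g K p) :
    divergence g K p ^ 2 ≤ 2 * LinearMap.trace ℝ (RSpace 4)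
      ((coordCovDeriv (g.inChart x₀) (vecInChart K x₀) (extChartAt (𝓡 4) x₀ p) :
        RSpace 4 →ₗ[ℝ] RSpace 4) ∘ₗ coordCovDeriv (g.inChart x₀) (vecInChart K x₀)
          (extChartAt (𝓡 4) x₀ p)) := by
  obtain ⟨b, hb⟩ := exists_isLorentzBasis g hp
  have hG := (contDiffAt_metric g hp).differentiableAt (by simp)
  have hk := (hK.contDiffAt hp).differentiableAt (by simp)
  rw [divergence_eq hK hp, coordDiv]
  refine sq_trace_le_of_symm hb (vecInChart_ne_zero hnull hp) (flatInChart_self hnull hp) ?_ ?_ ?_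
  · rw [vecInChart_extChartAt K hp]
    refine (chartDeriv_covDeriv g hp hK (K p)).symm.trans ?_
    rw [hgeod, map_zero]
  · exact metric_coordCovDeriv_self hG (eventually_metric_symm g hp) (isInvertible_metric g hp) hk
      (eventually_flatInChart_self hnull hp)
  · intro u v hu hv
    have h1 := (wedgeOneTwo_eq_zero_iff (flatInChart_ne_zero hnull hp)
      fun u v => by rw [curl_apply, curl_apply, neg_sub]).1
        ((isTwistFreeAt_iff hK hnull hp).1 h) u v hu hv
    exact sub_eq_zero.1 ((curl_lower hG (eventually_metric_symm g hp) (isInvertible_metric g hp)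
      hk u v).symm.trans h1)

/-- Under the strict null convergence condition a complete geodesic null field twists everywhere:
otherwise its divergence would satisfy `θ' < -θ²/2` along a complete integral curve. -/
lemma not_isTwistFreeAt (hK : IsSmoothVField K) (hcomplete : IsCompleteVField K)
    (hnull : g.IsNull K) (hgeod : ∀ x, g.covDeriv K x (K x) = 0)
    (hric : ∀ x, 0 < g.ricci K K x) (x : M) : ¬ IsTwistFreeAt g K x := by
  intro hx
  obtain ⟨γ, rfl, hγ⟩ := hcomplete x
  refine not_forall_riccati_lt (hasDerivAt_divergence hK hgeod hγ) fun t => ?_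
  have h := (hx.of_integralCurve hK hnull hgeod hγ t).sq_divergence_le hK hnull hgeod
    (mem_extChartAt_source (γ t))
  linarith [hric (γ t)]

end Twisting

/-! ### Liouville vector fields -/

section Liouville

variable {n : ℕ} {M : Type*} [TopologicalSpace M] [ChartedSpace (RSpace n) M]
  [IsManifold (𝓡 n) ∞ M] {x₀ p : M} {g : LorentzMetric n M} {T X : VField n M}

/-- If `i_X d(g(T, ·)) = g(T, ·)`, then `𝓛_X d(g(T, ·)) = d(g(T, ·))` by Cartan's formula. -/
lemma isLiouville_d_flat (hT : IsSmoothVField T) (hX : IsSmoothVField X)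
    (h : ∀ q (v : TangentSpace (𝓡 n) q), DForm.d (g.flat T) q ![X q, v] = g.val q (T q) v) :
    DForm.IsLiouville (DForm.d (g.flat T)) X := by
  refine ⟨hX, fun Y hY x => ?_⟩
  have hx : x ∈ (extChartAt (𝓡 n) x).source := mem_extChartAt_source x
  set y := extChartAt (𝓡 n) x x with hy
  set t := flatInChart g T x with ht_def
  have ht : ContDiffAt ℝ 2 t y := (contDiffAt_flatInChart g hT hx).of_le two_le_infty
  have hc := differentiableAt_curl ht
  have hY' : ∀ i, DifferentiableAt ℝ (vecInChart (Y i) x) y := fun i =>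
    ((hY i).contDiffAt hx).differentiableAt (by simp)
  have hpair : ∀ q : M, (fun i => Y i q) = ![Y 0 q, Y 1 q] := fun q => by
    funext i; fin_cases i <;> rfl
  have hiX : ∀ᶠ y' in 𝓝 y, curl t y' (vecInChart X x y') = t y' :=
    eventually_nhds_extChartAt hx fun q hq => by
      ext v
      rw [← (isInvertible_chartDeriv hq).self_apply_inverse v, vecInChart_extChartAt X hq,
        ← d_flat_apply g hT hq, flatInChart_chartDeriv g T hq, h]
  have hLie := lieDeriv_curl ht ((hX.contDiffAt hx).differentiableAt (by simp)) hiX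
    (vecInChart (Y 0) x y) (vecInChart (Y 1) x y)
  -- the function `X(ω(Y₀, Y₁))`
  have hloc : (fun q => DForm.d (g.flat T) q (fun i => Y i q)) ∘ (extChartAt (𝓡 n) x).symm
      =ᶠ[𝓝 y] fun y' => curl t y' (vecInChart (Y 0) x y') (vecInChart (Y 1) x y') :=
    eventually_nhds_extChartAt hx fun q hq => by
      rw [Function.comp_apply, (extChartAt (𝓡 n) x).left_inv hq, hpair, d_flat_apply g hT hq,
        ← vecInChart_extChartAt (Y 0) hq, ← vecInChart_extChartAt (Y 1) hq]
  have hder := (hc.hasFDerivAt.clm_apply (hY' 0).hasFDerivAt).clm_apply (hY' 1).hasFDerivAt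
  have hdir := dirDeriv_eq hx (hloc.differentiableAt_iff.2 hder.differentiableAt) X
  rw [← hy, hloc.fderiv_eq, hder.fderiv] at hdir
  -- the brackets
  have hbr : ∀ i, chartDeriv x x (VectorField.mlieBracket (𝓡 n) X (Y i) x) =
      fderiv ℝ (vecInChart (Y i) x) y (vecInChart X x y) -
        fderiv ℝ (vecInChart X x) y (vecInChart (Y i) x y) := fun i => by
    rw [chartDeriv_mlieBracket, hy, vecInChart_extChartAt X hx, vecInChart_extChartAt _ hx]
  have h0 : Function.update (fun j => Y j x) 0 (VectorField.mlieBracket (𝓡 n) X (Y 0) x) =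
      ![VectorField.mlieBracket (𝓡 n) X (Y 0) x, Y 1 x] := by
    funext i; fin_cases i <;> rfl
  have h1 : Function.update (fun j => Y j x) 1 (VectorField.mlieBracket (𝓡 n) X (Y 1) x) =
      ![Y 0 x, VectorField.mlieBracket (𝓡 n) X (Y 1) x] := by
    funext i; fin_cases i <;> rfl
  rw [DForm.lieDeriv, hdir, Fin.sum_univ_two, h0, h1, hpair, d_flat_apply g hT hx,
    d_flat_apply g hT hx, d_flat_apply g hT hx, hbr, hbr, ← hy, ← ht_def,
    ← vecInChart_extChartAt X hx, ← vecInChart_extChartAt (Y 0) hx,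
    ← vecInChart_extChartAt (Y 1) hx, ← hy, ← hLie]
  simp
  ring

end Liouville

/-! ### The form `d(g(e^f K, ·))` -/

section Symplectic

variable {n : ℕ} {M : Type*} [TopologicalSpace M] [ChartedSpace (RSpace n) M]
  [IsManifold (𝓡 n) ∞ M] {x₀ p : M} {g : LorentzMetric n M} {K : VField n M} {f : M → ℝ}

/-- `d(e^f a) = e^f (df ∧ a + da)`. -/
lemma curl_flatInChart_exp_smul (hK : IsSmoothVField K) (hf : ContMDiff (𝓡 n) 𝓘(ℝ, ℝ) ∞ f)
    (hp : p ∈ (extChartAt (𝓡 n) x₀).source) (u v : RSpace n) :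
    curl (flatInChart g (fun x => Real.exp (f x) • K x) x₀) (extChartAt (𝓡 n) x₀ p) u v =
      Real.exp (f p) *
        (fderiv ℝ (f ∘ (extChartAt (𝓡 n) x₀).symm) (extChartAt (𝓡 n) x₀ p) u *
            flatInChart g K x₀ (extChartAt (𝓡 n) x₀ p) v -
          fderiv ℝ (f ∘ (extChartAt (𝓡 n) x₀).symm) (extChartAt (𝓡 n) x₀ p) v *
            flatInChart g K x₀ (extChartAt (𝓡 n) x₀ p) u +
          curl (flatInChart g K x₀) (extChartAt (𝓡 n) x₀ p) u v) := by
  have hF := (contDiffAt_comp_symm hf hp).differentiableAt (by simp)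
  have hE : HasFDerivAt ((fun x => Real.exp (f x)) ∘ (extChartAt (𝓡 n) x₀).symm) _
    (extChartAt (𝓡 n) x₀ p) := hF.hasFDerivAt.exp
  rw [flatInChart_smul, curl_smul hE.differentiableAt
    ((contDiffAt_flatInChart g hK hp).differentiableAt (by simp)), hE.fderiv]
  simp only [smul_apply, smul_eq_mul, Function.comp_apply, (extChartAt (𝓡 n) x₀).left_inv hp]
  ring

/-- `i_K d(e^f a) = e^f K(f) a` for `a = g(K, ·)`. -/
lemma curl_flatInChart_exp_smul_self (hK : IsSmoothVField K) (hnull : g.IsNull K)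
    (hgeod : ∀ x, g.covDeriv K x (K x) = 0) (hf : ContMDiff (𝓡 n) 𝓘(ℝ, ℝ) ∞ f)
    (hp : p ∈ (extChartAt (𝓡 n) x₀).source) (v : RSpace n) :
    curl (flatInChart g (fun x => Real.exp (f x) • K x) x₀) (extChartAt (𝓡 n) x₀ p)
        (chartDeriv x₀ p (K p)) v =
      Real.exp (f p) * (dirDeriv K f p * flatInChart g K x₀ (extChartAt (𝓡 n) x₀ p) v) := by
  rw [curl_flatInChart_exp_smul hK hf hp, ← vecInChart_extChartAt K hp, flatInChart_self hnull hp,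
    curl_flatInChart_self hK hnull hgeod hp,
    dirDeriv_eq hp ((contDiffAt_comp_symm hf hp).differentiableAt (by simp)),
    vecInChart_extChartAt K hp]
  simp

end Symplectic

/-- If `d(g(K, ·))` does not vanish on `K^⊥`, then `d(g(e^f K, ·))` is nondegenerate. -/
lemma nondegenerate_d_flat_exp_smul {M : Type*} [TopologicalSpace M] [ChartedSpace (RSpace 4) M]
    [IsManifold (𝓡 4) ∞ M] {g : LorentzMetric 4 M} {K : VField 4 M} {f : M → ℝ}
    (hK : IsSmoothVField K) (hnull : g.IsNull K) (hgeod : ∀ x, g.covDeriv K x (K x) = 0)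
    (hf : ContMDiff (𝓡 4) 𝓘(ℝ, ℝ) ∞ f) {x : M} (hKf : dirDeriv K f x ≠ 0)
    (htwist : ¬ IsTwistFreeAt g K x) {v : TangentSpace (𝓡 4) x} (hv : v ≠ 0) :
    ∃ w, DForm.d (g.flat (fun x => Real.exp (f x) • K x)) x ![v, w] ≠ 0 := by
  by_contra! hzero
  have hx : x ∈ (extChartAt (𝓡 4) x).source := mem_extChartAt_source x
  have hi := isInvertible_chartDeriv (n := 4) hx
  have hexp : Real.exp (f x) ≠ 0 := (Real.exp_pos _).ne'
  set y := extChartAt (𝓡 4) x x with hy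
  set a := flatInChart g K x with ha
  have hT : IsSmoothVField (fun x => Real.exp (f x) • K x) :=
    hK.smul (Real.contDiff_exp.contMDiff.comp hf)
  have hz : ∀ w, curl (flatInChart g (fun x => Real.exp (f x) • K x) x) y
      (chartDeriv x x v) w = 0 := fun w => by
    rw [← hi.self_apply_inverse w, ← d_flat_apply g hT hx, hzero]
  -- Pairing with `K` shows that `v` is orthogonal to `K`.
  have hav : a y (chartDeriv x x v) = 0 := by
    have h1 := hz (chartDeriv x x (K x))
    rw [curl_apply, ← neg_sub, ← curl_apply,
      curl_flatInChart_exp_smul_self hK hnull hgeod hf hx, neg_eq_zero] at h1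
    exact (mul_eq_zero.1 ((mul_eq_zero.1 h1).resolve_left hexp)).resolve_left hKf
  -- Pairing with `K^⊥` shows that `v` is a multiple of `K`.
  have hcv : ∀ w, a y w = 0 → curl a y (chartDeriv x x v) w = 0 := fun w hw => by
    have h1 := hz w
    rw [curl_flatInChart_exp_smul hK hf hx, ← hy, ← ha, hw, hav] at h1
    simpa [hexp] using h1
  obtain ⟨u₀, v₀, hu₀, hv₀, hne⟩ : ∃ u v : TangentSpace (𝓡 4) x, g.val x (K x) u = 0 ∧
      g.val x (K x) v = 0 ∧ DForm.d (g.flat K) x ![u, v] ≠ 0 := by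
    simpa [IsTwistFreeAt] using htwist
  obtain ⟨b, hb⟩ := exists_isLorentzBasis g hx
  rw [← flatInChart_chartDeriv g K hx] at hu₀ hv₀
  rw [d_flat_apply g hK hx] at hne
  obtain ⟨r, hr⟩ := exists_smul_of_forall_eq_zero hb (vecInChart_ne_zero hnull hx)
    (flatInChart_self hnull hx) (β := curl a y)
    (fun u v => by rw [curl_apply, curl_apply, neg_sub])
    (fun w => by rw [curl_flatInChart_self hK hnull hgeod hx]; rfl) hu₀ hv₀ hne hav hcv
  -- Since `i_K ω` is a nonzero multiple of `g(K, ·) ≠ 0`, this multiple is zero.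
  have hr0 : r = 0 := by
    by_contra hr0
    refine flatInChart_ne_zero hnull hx (ContinuousLinearMap.ext fun w => ?_)
    have h1 := hz w
    rw [hr, map_smul, smul_apply, vecInChart_extChartAt K hx,
      curl_flatInChart_exp_smul_self hK hnull hgeod hf hx] at h1
    simpa [hexp, hKf, hr0] using h1
  rw [hr0, zero_smul] at hr
  exact hv (by rw [← hi.inverse_apply_self v, hr, map_zero])

end

theorem theorem1 {M : Type*} [TopologicalSpace M] [T2Space M] [SecondCountableTopology M]
    [ChartedSpace (RSpace 4) M] [IsManifold (𝓡 4) ∞ M] (g : LorentzMetric 4 M)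
    (K : VField 4 M) (hK : IsSmoothVField K) (hcomplete : IsCompleteVField K)
    (hnull : g.IsNull K) (hgeod : ∀ x, g.covDeriv K x (K x) = 0)
    (hric : ∀ x, 0 < g.ricci K K x)
    (f : M → ℝ) (hf : ContMDiff (𝓡 4) 𝓘(ℝ, ℝ) ∞ f) (hKf : ∀ x, dirDeriv K f x ≠ 0) :
    DForm.IsSymplectic (DForm.d (g.flat (fun x => Real.exp (f x) • K x))) ∧
      DForm.IsLiouville (DForm.d (g.flat (fun x => Real.exp (f x) • K x)))
        (fun x => (dirDeriv K f x)⁻¹ • K x) := by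
  have hT : IsSmoothVField (fun x => Real.exp (f x) • K x) :=
    hK.smul (Real.contDiff_exp.contMDiff.comp hf)
  have hX : IsSmoothVField (fun x => (dirDeriv K f x)⁻¹ • K x) :=
    hK.smul ((contMDiff_dirDeriv hf hK).inv₀ hKf)
  refine ⟨⟨(isSmooth_flat g hT).d, (isSmooth_flat g hT).d_d, fun x v hv => ?_⟩, ?_⟩
  · exact nondegenerate_d_flat_exp_smul hK hnull hgeod hf (hKf x)
      (not_isTwistFreeAt hK hcomplete hnull hgeod hric x) hv
  · refine isLiouville_d_flat hT hX fun q v => ?_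
    have hq := mem_extChartAt_source (I := 𝓡 4) q
    rw [d_flat_apply g hT hq, map_smul, map_smul, smul_apply,
      curl_flatInChart_exp_smul_self hK hnull hgeod hf hq, flatInChart_chartDeriv g K hq,
      map_smul, smul_apply, smul_eq_mul, smul_eq_mul]
    field_simp [hKf q]
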